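/- A *probability algebra* $X$ is a $\sigma$-complete Boolean algebra $\mathcal A_X$ with a countably additive $\mu_X\colon\mathcal A_X\to[0,1]$ such that $\mu_X(0)=0$, $\mu_X(1)=1$ and $\mu_X(E)>0$ for all $E\ne 0$. A *morphism* $\pi\colon X\to Y$ is a Boolean homomorphism $\pi^*\colon\mathcal A_Y\to\mathcal A_X$ that preserves countable joins and meets and satisfies $\mu_X(\pi^*E)=\mu_Y(E)$ for all $E\in\mathcal A_Y$. An abstractly measurable map $f\colon X\to Z$ to a measurable space $Z$ is a $\sigma$-homomorphism $f^*$ from the $\sigma$-algebra of $Z$ to $\mathcal A_X$. Let $L^\infty(X)$ be the unital commutative $C^*$-algebra of bounded abstractly measurable maps $f\colon X\to\mathbb C$ (operations are defined by composing the abstractly measurable map $(f,g)\colon X\to\mathbb C\times\mathbb C$ with the operations of $\mathbb C$), with the trace $\tau_X(f)=\int_{\mathbb C} z\,d(\mu_X\circ f^*)(z)$. The *canonical model* $\mathrm{Stone}(X)$ is the Gelfand spectrum of $L^\infty(X)$, i.e. the compact Hausdorff space of unital $*$-homomorphisms $\chi\colon L^\infty(X)\to\mathbb C$ with the topology of pointwise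 convergence, equipped with its Baire $\sigma$-algebra (generated by the continuous functions) and with the unique Radon probability measure $\mu_{\mathrm{Stone}(X)}$ such that $\int \chi(f)\,d\mu_{\mathrm{Stone}(X)}(\chi)=\tau_X(f)$ for all $f\in L^\infty(X)$. The morphism $\pi$ induces $\mathrm{Stone}(\pi)\colon\mathrm{Stone}(X)\to\mathrm{Stone}(Y)$, $\chi\mapsto\bigl(f\mapsto\chi(f\circ\pi)\bigr)$. Measures are defined on the Baire $\sigma$-algebra, and *Radon* means inner regular with respect to compact $G_\delta$ sets. **Theorem (Canonical disintegration).** Let $\pi\colon X\to Y$ be a morphism of probability algebras. Then there is a unique family $(\mu_y)_{y\in\mathrm{Stone}(Y)}$ of Radon probability measures on $\mathrm{Stone}(X)$ such that 1. for every $f\in C(\mathrm{Stone}(X),\mathbb C)$ the function $y\mapsto\int_{\mathrm{Stone}(X)} f\,d\mu_y$ is continuous on $\mathrm{Stone}(Y)$, and 2. for all $f\in C(\mathrm{Stone}(X),\mathbb C)$ and $g\in C(\mathrm{Stone}(Y),\mathbb C)$, $$\int_{\mathrm{Stone}(X)} f(x)\,g(\mathrm{Stone}(\pi)(x))\,d\mu_{\mathrm{Stone}(X)}(x)=\int_{\mathrm{Stone}(Y)}\Bigl(\int_{\mathrm{Stone}(X)}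 f\,d\mu_y\Bigr)g(y)\,d\mu_{\mathrm{Stone}(Y)}(y).$$ Furthermore, for every $y\in\mathrm{Stone}(Y)$, the fibre $\mathrm{Stone}(\pi)^{-1}(\{y\})$ is compact and $\mu_y$ is supported on it, in the sense that $\mu_y(E)=0$ for every (Baire) measurable set $E$ disjoint from $\mathrm{Stone}(\pi)^{-1}(\{y\})$. -/

import Mathlib

open MeasureTheory Set Filter Topology

universe u v w

namespace CanonicalModel

/-! ### Measurable sets, Baire sets, Radon measures -/

/-- The Boolean algebra of measurable subsets of a measurable space. -/
abbrev MSet (Z : Type*) [MeasurableSpace Z] : Type _ := Subtype (MeasurableSet : Set Z → Prop)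

/-- The Baire `σ`-algebra of a (compact Hausdorff) space: the `σ`-algebra generated by the continuous
complex-valued functions. -/
noncomputable abbrev baire (Z : Type*) [TopologicalSpace Z] : MeasurableSpace Z :=
  ⨆ f : C(Z, ℂ), MeasurableSpace.comap f (borel ℂ)

/-- A finite measure is Radon if it is inner regular with respect to the (measurable) compact
`G_δ` sets. -/
def IsRadon {Z : Type*} [TopologicalSpace Z] [MeasurableSpace Z] (μ : Measure Z) : Prop :=
  μ.InnerRegularWRT (fun K => MeasurableSet K ∧ IsCompact K ∧ IsGδ K) MeasurableSet

/-! ### `σ`-homomorphisms and probability algebras -/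

/-- A homomorphism of Boolean algebras which preserves countable joins
(hence, by taking complements, countable meets). -/
structure SigmaHom (A : Type*) (B : Type*) [BooleanAlgebra A] [BooleanAlgebra B]
    extends BoundedLatticeHom A B where
  map_isLUB : ∀ (E : ℕ → A) (s : A), IsLUB (range E) s →
    IsLUB (range fun n => toFun (E n)) (toFun s)

/-- A probability algebra: a `σ`-complete Boolean algebra with a countably additive
probability measure that is positive on all non-zero elements. -/
structure ProbAlg where
  carrier : Type u
  [booleanAlgebra : BooleanAlgebra carrier]
  exists_isLUB : ∀ E : ℕ → carrier, ∃ s, IsLUB (range E) s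
  μ : carrier → ℝ
  μ_mem : ∀ E, μ E ∈ Icc (0 : ℝ) 1
  μ_bot : μ ⊥ = 0
  μ_top : μ ⊤ = 1
  μ_hasSum : ∀ E : ℕ → carrier, (∀ m n, m ≠ n → E m ⊓ E n = ⊥) → ∀ s, IsLUB (range E) s →
    HasSum (fun n => μ (E n)) (μ s)
  μ_pos : ∀ E, E ≠ ⊥ → 0 < μ E

attribute [instance] ProbAlg.booleanAlgebra

/-- A morphism `X → Y` of probability algebras. As for maps of spaces, the underlying
`σ`-homomorphism `pullback` goes from the algebra of `Y` to the algebra of `X`; it preserves the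
measure. -/
structure ProbAlg.Hom (X : ProbAlg.{u}) (Y : ProbAlg.{v}) where
  pullback : SigmaHom Y.carrier X.carrier
  measure_pullback : ∀ E, X.μ (pullback.toFun E) = Y.μ E

/-! ### Abstractly measurable functions -/

/-- An abstractly measurable map from a probability algebra `X` to a measurable space `Z`:
a `σ`-homomorphism from the `σ`-algebra of `Z` to the algebra of `X`. One should think of
`f.toFun S` as the preimage of `S` under `f`. -/
abbrev AbsMor (X : ProbAlg.{u}) (Z : Type w) [MeasurableSpace Z] : Type _ :=
  SigmaHom (MSet Z) X.carrier

theorem SigmaHom.ext' {A B : Type*} [BooleanAlgebra A] [BooleanAlgebra B] {f g : SigmaHom A B}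
    (h : ∀ a, f.toFun a = g.toFun a) : f = g := by
  obtain ⟨⟨⟨⟨f, _⟩, _⟩, _, _⟩, _⟩ := f
  obtain ⟨⟨⟨⟨g, _⟩, _⟩, _, _⟩, _⟩ := g
  have : f = g := funext h
  subst this
  rfl

theorem MSet.isLUB_iff {Z : Type*} [MeasurableSpace Z] (E : ℕ → MSet Z) (s : MSet Z) :
    IsLUB (range E) s ↔ s.1 = ⋃ n, (E n).1 := by
  have key : IsLUB (range E) ⟨⋃ n, (E n).1, MeasurableSet.iUnion fun n => (E n).2⟩ := by
    constructor
    · rintro _ ⟨n, rfl⟩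
      exact Set.subset_iUnion (fun n => (E n).1) n
    · intro t ht
      exact Set.iUnion_subset fun n => ht ⟨n, rfl⟩
  constructor
  · intro h
    rw [h.unique key]
  · intro h
    have : s = ⟨⋃ n, (E n).1, MeasurableSet.iUnion fun n => (E n).2⟩ := Subtype.ext h
    rw [this]
    exact key

/-- The composition `h ∘ f` of an abstractly measurable map `f : X → Z` with a measurable map
`h : Z → W`. -/
def AbsMor.map {X : ProbAlg.{u}} {Z : Type*} {W : Type*} [MeasurableSpace Z] [MeasurableSpace W]
    (f : AbsMor X Z) (h : Z → W) (hh : Measurable h) : AbsMor X W where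
  toFun S := f.toFun ⟨h ⁻¹' S.1, hh S.2⟩
  map_sup' S T := f.map_sup' ⟨h ⁻¹' S.1, hh S.2⟩ ⟨h ⁻¹' T.1, hh T.2⟩
  map_inf' S T := f.map_inf' ⟨h ⁻¹' S.1, hh S.2⟩ ⟨h ⁻¹' T.1, hh T.2⟩
  map_top' := f.map_top'
  map_bot' := f.map_bot'
  map_isLUB E s hs := by
    refine f.map_isLUB (fun n => ⟨h ⁻¹' (E n).1, hh (E n).2⟩) ⟨h ⁻¹' s.1, hh s.2⟩ ?_
    rw [MSet.isLUB_iff] at hs ⊢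
    simp [hs]

/-- The composition `f ∘ π` of an abstractly measurable map `f : Y → Z` with a morphism
`π : X → Y` of probability algebras. -/
def AbsMor.comp {X : ProbAlg.{u}} {Y : ProbAlg.{v}} {Z : Type*} [MeasurableSpace Z]
    (f : AbsMor Y Z) (π : ProbAlg.Hom X Y) : AbsMor X Z where
  toFun S := π.pullback.toFun (f.toFun S)
  map_sup' S T := by
    rw [show f.toFun (S ⊔ T) = f.toFun S ⊔ f.toFun T from f.map_sup' S T]
    exact π.pullback.map_sup' _ _
  map_inf' S T := by
    rw [show f.toFun (S ⊓ T) = f.toFun S ⊓ f.toFun T from f.map_inf' S T]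
    exact π.pullback.map_inf' _ _
  map_top' := by
    rw [show f.toFun ⊤ = ⊤ from f.map_top']
    exact π.pullback.map_top'
  map_bot' := by
    rw [show f.toFun ⊥ = ⊥ from f.map_bot']
    exact π.pullback.map_bot'
  map_isLUB E s hs := π.pullback.map_isLUB _ _ (f.map_isLUB E s hs)

open Classical in
/-- The constant map with value `z`. -/
noncomputable def AbsMor.const (X : ProbAlg.{u}) {Z : Type*} [MeasurableSpace Z] (z : Z) :
    AbsMor X Z where
  toFun S := if z ∈ S.1 then ⊤ else ⊥
  map_sup' S T := by
    by_cases h1 : z ∈ S.1 <;> by_cases h2 : z ∈ T.1 <;> simp [h1, h2]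
  map_inf' S T := by
    by_cases h1 : z ∈ S.1 <;> by_cases h2 : z ∈ T.1 <;> simp [h1, h2]
  map_top' := if_pos (Set.mem_univ z)
  map_bot' := if_neg (Set.notMem_empty z)
  map_isLUB E s hs := by
    rw [MSet.isLUB_iff] at hs
    constructor
    · rintro _ ⟨n, rfl⟩
      by_cases h : z ∈ (E n).1
      · have : z ∈ s.1 := by rw [hs]; exact Set.mem_iUnion.2 ⟨n, h⟩
        simp [this]
      · simp [h]
    · intro t ht
      by_cases h : z ∈ s.1
      · rw [hs] at h
        obtain ⟨n, hn⟩ := Set.mem_iUnion.1 h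
        have h2 := ht ⟨n, rfl⟩
        simp only [hn, if_true] at h2
        exact le_trans le_top h2
      · simp [h]

/-- The distribution of an abstractly measurable map `f : X → Z`, i.e. the measure
`S ↦ μ_X (f⁻¹ S)` on `Z`. -/
noncomputable def AbsMor.law {X : ProbAlg.{u}} {Z : Type*} [MeasurableSpace Z] (f : AbsMor X Z) :
    Measure Z :=
  Measure.ofMeasurable (fun S hS => ENNReal.ofReal (X.μ (f.toFun ⟨S, hS⟩)))
    (by
      have : f.toFun ⟨∅, MeasurableSet.empty⟩ = ⊥ := f.map_bot'
      rw [this, X.μ_bot, ENNReal.ofReal_zero])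
    (by
      intro S hS hd
      have hs := X.μ_hasSum (fun n => f.toFun ⟨S n, hS n⟩)
        (by
          intro m n hmn
          have h1 : (⟨S m, hS m⟩ : MSet Z) ⊓ ⟨S n, hS n⟩ = ⊥ :=
            Subtype.ext (Set.disjoint_iff_inter_eq_empty.1 (hd hmn))
          have h2 : f.toFun ((⟨S m, hS m⟩ : MSet Z) ⊓ ⟨S n, hS n⟩) =
            f.toFun ⟨S m, hS m⟩ ⊓ f.toFun ⟨S n, hS n⟩ := f.map_inf' _ _
          rw [← h2, h1]
          exact f.map_bot') _
        (f.map_isLUB (fun n => ⟨S n, hS n⟩) ⟨⋃ n, S n, MeasurableSet.iUnion hS⟩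
          ((MSet.isLUB_iff _ _).2 rfl))
      rw [← hs.tsum_eq, ENNReal.ofReal_tsum_of_nonneg (fun n => (X.μ_mem _).1) hs.summable])

theorem AbsMor.law_apply {X : ProbAlg.{u}} {Z : Type*} [MeasurableSpace Z] (f : AbsMor X Z)
    {S : Set Z} (hS : MeasurableSet S) : f.law S = ENNReal.ofReal (X.μ (f.toFun ⟨S, hS⟩)) :=
  Measure.ofMeasurable_apply _ hS

/-! ### The algebra `L^∞(X)` and its trace -/

/-- `L^∞(X)`: the bounded abstractly measurable functions `X → ℂ`. -/
def Linfty (X : ProbAlg.{u}) : Type u :=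
  {f : AbsMor X ℂ // ∃ M : ℝ, f.toFun ⟨Metric.closedBall 0 M, measurableSet_closedBall⟩ = ⊤}

/-- `h` is the result of applying the measurable binary operation `op` to `f` and `g`, that is
`h = op ∘ (f, g)` where `(f, g) : X → ℂ × ℂ` is the abstractly measurable map with
components `f` and `g` (this map exists and is unique as `ℂ` is standard Borel). For `op` the addition (multiplication) of `ℂ` this defines the sum (product)
`h` of `f` and `g` in `L^∞(X)`. -/
def Linfty.IsBinop {X : ProbAlg.{u}} (op : ℂ × ℂ → ℂ) (hop : Measurable op)
    (f g h : Linfty X) : Prop :=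
  ∃ k : AbsMor X (ℂ × ℂ), k.map Prod.fst measurable_fst = f.1 ∧
    k.map Prod.snd measurable_snd = g.1 ∧ k.map op hop = h.1

/-- `h = f + g` in `L^∞(X)`. -/
def Linfty.IsAdd {X : ProbAlg.{u}} (f g h : Linfty X) : Prop :=
  Linfty.IsBinop (fun z => z.1 + z.2) (measurable_fst.add measurable_snd) f g h

/-- `h = f * g` in `L^∞(X)`. -/
def Linfty.IsMul {X : ProbAlg.{u}} (f g h : Linfty X) : Prop :=
  Linfty.IsBinop (fun z => z.1 * z.2) (measurable_fst.mul measurable_snd) f g h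

/-- The unit of `L^∞(X)`. -/
noncomputable def Linfty.one (X : ProbAlg.{u}) : Linfty X :=
  ⟨AbsMor.const X 1, 1, by simp [AbsMor.const]⟩

theorem SigmaHom.mono {A B : Type*} [BooleanAlgebra A] [BooleanAlgebra B] (f : SigmaHom A B)
    {a b : A} (h : a ≤ b) : f.toFun a ≤ f.toFun b := by
  have : f.toFun (a ⊓ b) = f.toFun a ⊓ f.toFun b := f.map_inf' a b
  rw [inf_eq_left.2 h] at this
  exact inf_eq_left.1 this.symm

theorem AbsMor.map_bounded {X : ProbAlg.{u}} {f : AbsMor X ℂ} {M M' : ℝ} {h : ℂ → ℂ}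
    (hh : Measurable h) (hM : ∀ z, ‖z‖ ≤ M → ‖h z‖ ≤ M')
    (hf : f.toFun ⟨Metric.closedBall 0 M, measurableSet_closedBall⟩ = ⊤) :
    (f.map h hh).toFun ⟨Metric.closedBall 0 M', measurableSet_closedBall⟩ = ⊤ := by
  rw [eq_top_iff, ← hf]
  refine SigmaHom.mono f ?_
  intro z hz
  simpa using hM z (by simpa using hz)

/-- Scalar multiplication on `L^∞(X)`. -/
noncomputable def Linfty.smul {X : ProbAlg.{u}} (c : ℂ) (f : Linfty X) : Linfty X :=
  ⟨f.1.map (fun z => c * z) (measurable_id.const_mul c), by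
    obtain ⟨M, hM⟩ := f.2
    refine ⟨‖c‖ * M, AbsMor.map_bounded _ (fun z hz => ?_) hM⟩
    rw [norm_mul]
    gcongr⟩

/-- Complex conjugation on `L^∞(X)`. -/
noncomputable def Linfty.conj {X : ProbAlg.{u}} (f : Linfty X) : Linfty X :=
  ⟨f.1.map (starRingEnd ℂ) Complex.continuous_conj.measurable, by
    obtain ⟨M, hM⟩ := f.2
    exact ⟨M, AbsMor.map_bounded _ (fun z hz => by simpa using hz) hM⟩⟩

/-- The trace `f ↦ ∫_X f` on `L^∞(X)`. -/
noncomputable def Linfty.trace {X : ProbAlg.{u}} (f : Linfty X) : ℂ := ∫ z, z ∂f.1.law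

/-- The Koopman operator `L^∞(π) : L^∞(Y) → L^∞(X)`, `f ↦ f ∘ π`. -/
noncomputable def Linfty.koopman {X : ProbAlg.{u}} {Y : ProbAlg.{v}} (π : ProbAlg.Hom X Y) (f : Linfty Y) :
    Linfty X :=
  ⟨f.1.comp π, by
    obtain ⟨M, hM⟩ := f.2
    refine ⟨M, ?_⟩
    change π.pullback.toFun (f.1.toFun _) = ⊤
    rw [hM]
    exact π.pullback.map_top'⟩

/-! ### The canonical model -/

/-- The underlying space of the canonical model of `X`: the Gelfand spectrum of `L^∞(X)`, that is
the set of all unital `*`-homomorphisms `L^∞(X) → ℂ`. -/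
structure Stone (X : ProbAlg.{u}) where
  toFun : Linfty X → ℂ
  map_one : toFun (Linfty.one X) = 1
  map_smul : ∀ c f, toFun (Linfty.smul c f) = c * toFun f
  map_conj : ∀ f, toFun (Linfty.conj f) = starRingEnd ℂ (toFun f)
  map_add : ∀ f g h, Linfty.IsAdd f g h → toFun h = toFun f + toFun g
  map_mul : ∀ f g h, Linfty.IsMul f g h → toFun h = toFun f * toFun g

/-- The topology induced from the product topology on the functions `L^∞(X) → ℂ`. -/
noncomputable instance Stone.instTopologicalSpace (X : ProbAlg.{u}) : TopologicalSpace (Stone X) :=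
  TopologicalSpace.induced Stone.toFun inferInstance

/-- The canonical model is equipped with its Baire `σ`-algebra. -/
noncomputable instance Stone.instMeasurableSpace (X : ProbAlg.{u}) : MeasurableSpace (Stone X) :=
  baire (Stone X)

/-- The map `Stone(π) : Stone(X) → Stone(Y)`, `χ ↦ χ ∘ L^∞(π)`. -/
noncomputable def Stone.map {X : ProbAlg.{u}} {Y : ProbAlg.{v}} (π : ProbAlg.Hom X Y) (χ : Stone X) :
    Stone Y where
  toFun f := χ.toFun (Linfty.koopman π f)
  map_one := by
    rw [← χ.map_one]
    congr 1
    refine Subtype.ext (SigmaHom.ext' fun S => ?_)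
    by_cases h : (1 : ℂ) ∈ S.1
    · simp only [Linfty.koopman, Linfty.one, AbsMor.comp, AbsMor.const, if_pos h]
      exact π.pullback.map_top'
    · simp only [Linfty.koopman, Linfty.one, AbsMor.comp, AbsMor.const, if_neg h]
      exact π.pullback.map_bot'
  map_smul c f := χ.map_smul c (Linfty.koopman π f)
  map_conj f := χ.map_conj (Linfty.koopman π f)
  map_add := by
    rintro f g h ⟨k, h1, h2, h3⟩
    refine χ.map_add _ _ _ ⟨k.comp π, ?_, ?_, ?_⟩
    · exact congrArg (fun l => AbsMor.comp l π) h1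
    · exact congrArg (fun l => AbsMor.comp l π) h2
    · exact congrArg (fun l => AbsMor.comp l π) h3
  map_mul := by
    rintro f g h ⟨k, h1, h2, h3⟩
    refine χ.map_mul _ _ _ ⟨k.comp π, ?_, ?_, ?_⟩
    · exact congrArg (fun l => AbsMor.comp l π) h1
    · exact congrArg (fun l => AbsMor.comp l π) h2
    · exact congrArg (fun l => AbsMor.comp l π) h3

/-- A measure `ν` on the spectrum represents the trace of `L^∞(X)` if `∫ χ(f) dν(χ) = ∫_X f` for all
`f` in `L^∞(X)`. -/
def RepresentsTrace (X : ProbAlg.{u}) (ν : Measure (Stone X)) : Prop :=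
  ∀ f : Linfty X, ∫ χ, χ.toFun f ∂ν = f.trace

/-! ### Existence of the measure of the canonical model -/

section Existence

variable (X : ProbAlg.{u})

/-- The ultrafilters of the algebra of `X`, as prime ideals of the associated Boolean ring. -/
abbrev Ult : Type u := PrimeSpectrum (AsBoolRing X.carrier)

variable {X}

/-- The set of ultrafilters that contain `E`. -/
def cyl (E : X.carrier) : Set (Ult X) := {u | toBoolRing E ∉ u.asIdeal}

theorem cyl_eq (E : X.carrier) : cyl E = (PrimeSpectrum.basicOpen (toBoolRing E) : Set (Ult X)) :=
  rfl

theorem cyl_inf (E F : X.carrier) : cyl (E ⊓ F) = cyl E ∩ cyl F := by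
  ext u
  have : toBoolRing (E ⊓ F) = toBoolRing E * toBoolRing F := rfl
  simp only [cyl, this, mem_ofPred_eq, u.2.mul_mem_iff_mem_or_mem, not_or, mem_inter_iff]

theorem cyl_top : cyl (⊤ : X.carrier) = univ := by
  ext u
  have : toBoolRing (⊤ : X.carrier) = 1 := rfl
  simp only [cyl, this, mem_ofPred_eq, mem_univ, iff_true]
  exact fun h => u.2.ne_top ((Ideal.eq_top_iff_one _).2 h)

theorem cyl_bot : cyl (⊥ : X.carrier) = ∅ := by
  ext u
  have : toBoolRing (⊥ : X.carrier) = 0 := rfl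
  simp [cyl, this]

theorem cyl_compl (E : X.carrier) : cyl Eᶜ = (cyl E)ᶜ := by
  ext u
  have h1 : toBoolRing E * toBoolRing Eᶜ = 0 := by
    change toBoolRing (E ⊓ Eᶜ) = toBoolRing ⊥
    simp
  have h2 : toBoolRing E + toBoolRing Eᶜ = 1 := by
    change toBoolRing (symmDiff E Eᶜ) = toBoolRing ⊤
    simp
  simp only [cyl, mem_ofPred_eq, mem_compl_iff, not_not]
  constructor
  · intro h
    have : toBoolRing E * toBoolRing Eᶜ ∈ u.asIdeal := by rw [h1]; exact u.asIdeal.zero_mem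
    exact (u.2.mem_or_mem this).resolve_right h
  · intro h h'
    refine u.2.ne_top ((Ideal.eq_top_iff_one _).2 ?_)
    rw [← h2]
    exact u.asIdeal.add_mem h h'

theorem cyl_sup (E F : X.carrier) : cyl (E ⊔ F) = cyl E ∪ cyl F := by
  have : E ⊔ F = (Eᶜ ⊓ Fᶜ)ᶜ := by simp
  rw [this, cyl_compl, cyl_inf, cyl_compl, cyl_compl, Set.compl_inter, compl_compl, compl_compl]

theorem cyl_mono {E F : X.carrier} (h : E ≤ F) : cyl E ⊆ cyl F := by
  rw [← inf_eq_left.2 h, cyl_inf]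
  exact inter_subset_right

theorem cyl_eq_empty {E : X.carrier} (h : cyl E = ∅) : E = ⊥ := by
  rw [cyl_eq] at h
  have h2 : PrimeSpectrum.basicOpen (toBoolRing E) = ⊥ := TopologicalSpace.Opens.ext h
  rw [PrimeSpectrum.basicOpen_eq_bot_iff] at h2
  obtain ⟨n, hn⟩ := h2
  have h3 : toBoolRing E ^ (n + 1) = toBoolRing E := by
    induction n with
    | zero => simp
    | succ n ih => 
      have : ∀ m : ℕ, toBoolRing E ^ (m + 1) = toBoolRing E := by
        intro m
        induction m with
        | zero => simp
        | succ m ihm => rw [pow_succ, ihm, BooleanRing.mul_self]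
      exact this _
  rw [pow_succ, hn, zero_mul] at h3
  exact h3.symm

theorem cyl_injective : Function.Injective (cyl : X.carrier → Set (Ult X)) := by
  have key : ∀ E F : X.carrier, cyl E ⊆ cyl F → E ≤ F := by
    intro E F h
    have : cyl (E ⊓ Fᶜ) = ∅ := by
      rw [cyl_inf, cyl_compl, ← Set.sdiff_eq, Set.sdiff_eq_empty]
      exact h
    exact le_compl_compl.trans' (disjoint_iff.2 (cyl_eq_empty this)).le_compl_right |>.trans
      (by simp)
  intro E F h
  exact le_antisymm (key _ _ h.le) (key _ _ h.ge)

theorem isOpen_cyl (E : X.carrier) : IsOpen (cyl E) := (PrimeSpectrum.basicOpen _).2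

theorem isClosed_cyl (E : X.carrier) : IsClosed (cyl E) := by
  rw [← isOpen_compl_iff, ← cyl_compl]
  exact isOpen_cyl _

theorem isCompact_cyl (E : X.carrier) : IsCompact (cyl E) := (isClosed_cyl E).isCompact

theorem isSetRing_cyl : IsSetRing (range (cyl : X.carrier → Set (Ult X))) where
  empty_mem := ⟨⊥, cyl_bot⟩
  union_mem := by
    rintro _ _ ⟨E, rfl⟩ ⟨F, rfl⟩
    exact ⟨E ⊔ F, cyl_sup E F⟩
  sdiff_mem := by
    rintro _ _ ⟨E, rfl⟩ ⟨F, rfl⟩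
    exact ⟨E ⊓ Fᶜ, by rw [cyl_inf, cyl_compl, Set.sdiff_eq]⟩

theorem μ_sup (E F : X.carrier) (h : E ⊓ F = ⊥) : X.μ (E ⊔ F) = X.μ E + X.μ F := by
  have := X.μ_hasSum (fun n => if n = 0 then E else if n = 1 then F else ⊥)
    (by
      intro m n hmn
      rcases m with _ | _ | m <;> rcases n with _ | _ | n <;> simp_all [inf_comm])
    (E ⊔ F)
    (by
      constructor
      · rintro _ ⟨n, rfl⟩
        rcases n with _ | _ | n <;> simp
      · intro t ht
        exact sup_le (by simpa using ht ⟨0, rfl⟩) (by simpa using ht ⟨1, rfl⟩))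
  have h2 : HasSum (fun n => X.μ (if n = 0 then E else if n = 1 then F else ⊥))
      (∑ n ∈ Finset.range 2, X.μ (if n = 0 then E else if n = 1 then F else ⊥)) := by
    apply hasSum_sum_of_ne_finset_zero
    intro n hn
    rcases n with _ | _ | n <;> simp_all [X.μ_bot]
  rw [this.unique h2]
  simp [Finset.sum_range_succ]

open Classical in
/-- The set function `cyl E ↦ μ E`. -/
noncomputable def cylFun (X : ProbAlg.{u}) (s : Set (Ult X)) : ENNReal :=
  if h : ∃ E, cyl E = s then ENNReal.ofReal (X.μ h.choose) else 0

theorem cylFun_cyl (E : X.carrier) : cylFun X (cyl E) = ENNReal.ofReal (X.μ E) := by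
  have h : ∃ F, cyl F = cyl E := ⟨E, rfl⟩
  rw [cylFun, dif_pos h, cyl_injective h.choose_spec]

/-- The content `cyl E ↦ μ E`. -/
noncomputable def cylContent (X : ProbAlg.{u}) :
    AddContent ENNReal (range (cyl : X.carrier → Set (Ult X))) :=
  isSetRing_cyl.addContent_of_union (cylFun X)
    (by rw [← cyl_bot, cylFun_cyl, X.μ_bot, ENNReal.ofReal_zero])
    (by
      rintro _ _ ⟨E, rfl⟩ ⟨F, rfl⟩ hd
      rw [← cyl_sup, cylFun_cyl, cylFun_cyl, cylFun_cyl, μ_sup, ENNReal.ofReal_add]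
      · exact (X.μ_mem E).1
      · exact (X.μ_mem F).1
      · apply cyl_eq_empty
        rw [cyl_inf]
        exact Set.disjoint_iff_inter_eq_empty.1 hd)

theorem cylContent_cyl (E : X.carrier) : cylContent X (cyl E) = ENNReal.ofReal (X.μ E) :=
  cylFun_cyl E

theorem cylContent_subadd : (cylContent X).IsSigmaSubadditive := by
  intro f hf hU
  obtain ⟨E, hE⟩ := hU
  have hc : IsCompact (⋃ i, f i) := by
    rw [← hE]
    exact isCompact_cyl E
  obtain ⟨t, ht⟩ := hc.elim_finite_subcover f
    (fun i => by obtain ⟨F, hF⟩ := hf i; rw [← hF]; exact isOpen_cyl F) subset_rfl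
  have h1 : ⋃ i, f i = ⋃ i ∈ t, f i := 
    subset_antisymm ht (iUnion₂_subset fun i _ => subset_iUnion f i)
  rw [h1]
  refine (addContent_biUnion_le isSetRing_cyl (fun n _ => hf n)).trans ?_
  exact ENNReal.sum_le_tsum t

/-- The `σ`-algebra generated by the sets `cyl E`. -/
noncomputable instance instMeasurableSpaceUlt : MeasurableSpace (Ult X) :=
  MeasurableSpace.generateFrom (range (cyl : X.carrier → Set (Ult X)))

theorem measurableSet_cyl (E : X.carrier) : MeasurableSet (cyl E) :=
  MeasurableSpace.measurableSet_generateFrom ⟨E, rfl⟩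

/-- The measure on the space of ultrafilters with `cyl E ↦ μ E`. -/
noncomputable def ultMeasure (X : ProbAlg.{u}) : Measure (Ult X) :=
  (cylContent X).measure isSetRing_cyl.isSetSemiring le_rfl cylContent_subadd

theorem ultMeasure_cyl (E : X.carrier) : ultMeasure X (cyl E) = ENNReal.ofReal (X.μ E) := by
  rw [← cylContent_cyl]
  exact AddContent.measure_eq _ isSetRing_cyl.isSetSemiring rfl cylContent_subadd ⟨E, rfl⟩

instance : IsProbabilityMeasure (ultMeasure X) :=
  ⟨by rw [← cyl_top, ultMeasure_cyl, X.μ_top, ENNReal.ofReal_one]⟩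

/-- The push-forward of an ultrafilter under an abstractly measurable map. -/
def pushFilter {Z : Type*} [MeasurableSpace Z] (u : Ult X) (f : AbsMor X Z) : Filter Z where
  sets := {T | ∃ S : MSet Z, S.1 ⊆ T ∧ u ∈ cyl (f.toFun S)}
  univ_sets := ⟨⊤, subset_univ _, by
    rw [show f.toFun ⊤ = ⊤ from f.map_top', cyl_top]; exact mem_univ _⟩
  sets_of_superset := by
    rintro T T' ⟨S, h1, h2⟩ h
    exact ⟨S, h1.trans h, h2⟩
  inter_sets := by
    rintro T T' ⟨S, h1, h2⟩ ⟨S', h1', h2'⟩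
    refine ⟨S ⊓ S', inter_subset_inter h1 h1', ?_⟩
    rw [show f.toFun (S ⊓ S') = f.toFun S ⊓ f.toFun S' from f.map_inf' S S', cyl_inf]
    exact ⟨h2, h2'⟩

theorem mem_pushFilter {Z : Type*} [MeasurableSpace Z] {u : Ult X} {f : AbsMor X Z} {T : Set Z} :
    T ∈ pushFilter u f ↔ ∃ S : MSet Z, S.1 ⊆ T ∧ u ∈ cyl (f.toFun S) := Iff.rfl

instance pushFilter_neBot {Z : Type*} [MeasurableSpace Z] (u : Ult X) (f : AbsMor X Z) :
    (pushFilter u f).NeBot := by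
  rw [← Filter.empty_mem_iff_bot.not.trans Filter.neBot_iff.symm]
  rintro ⟨S, h1, h2⟩
  have : S = ⊥ := Subtype.ext (subset_empty_iff.1 h1)
  rw [this, show f.toFun ⊥ = ⊥ from f.map_bot', cyl_bot] at h2
  exact h2

theorem mem_or_compl {Z : Type*} [MeasurableSpace Z] (u : Ult X) (f : AbsMor X Z) (S : MSet Z) :
    u ∈ cyl (f.toFun S) ∨ u ∈ cyl (f.toFun Sᶜ) := by
  rw [← Set.mem_union, ← cyl_sup,
    ← show f.toFun (S ⊔ Sᶜ) = f.toFun S ⊔ f.toFun Sᶜ from f.map_sup' S Sᶜ, sup_compl_eq_top,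
    show f.toFun ⊤ = ⊤ from f.map_top', cyl_top]
  exact mem_univ u

theorem tendsto_pushFilter {Z W : Type*} [MeasurableSpace Z] [MeasurableSpace W] (u : Ult X)
    (f : AbsMor X Z) (h : Z → W) (hh : Measurable h) :
    Tendsto h (pushFilter u f) (pushFilter u (f.map h hh)) := by
  rintro T ⟨S, h1, h2⟩
  exact ⟨⟨h ⁻¹' S.1, hh S.2⟩, preimage_mono h1, h2⟩

theorem exists_lim (u : Ult X) (f : Linfty X) : ∃ z : ℂ, pushFilter u f.1 ≤ 𝓝 z := by
  obtain ⟨M, hM⟩ := f.2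
  have hmem : Metric.closedBall (0 : ℂ) M ∈ pushFilter u f.1 :=
    ⟨⟨_, measurableSet_closedBall⟩, subset_rfl, by rw [hM, cyl_top]; exact mem_univ _⟩
  obtain ⟨z, -, hz⟩ := (isCompact_closedBall (0 : ℂ) M).exists_clusterPt
    (f := pushFilter u f.1) (Filter.le_principal_iff.2 hmem)
  refine ⟨z, fun T hT => ?_⟩
  obtain ⟨O, hO, hOo, hzO⟩ := mem_nhds_iff.1 hT
  rcases mem_or_compl u f.1 ⟨O, hOo.measurableSet⟩ with h | h
  · exact ⟨_, hO, h⟩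
  · exfalso
    have h1 : Oᶜ ∈ pushFilter u f.1 := ⟨_, subset_rfl, h⟩
    obtain ⟨w, hw1, hw2⟩ := clusterPt_iff_nonempty.1 hz (hOo.mem_nhds hzO) h1
    exact hw2 hw1

/-- The value at `u` of the continuous function corresponding to `f`. -/
noncomputable def ultLim (u : Ult X) (f : Linfty X) : ℂ := (exists_lim u f).choose

theorem le_ultLim (u : Ult X) (f : Linfty X) : pushFilter u f.1 ≤ 𝓝 (ultLim u f) :=
  (exists_lim u f).choose_spec

theorem ultLim_map (u : Ult X) (f h : Linfty X) (op : ℂ → ℂ) (hop : Continuous op)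
    (hh : f.1.map op hop.measurable = h.1) : ultLim u h = op (ultLim u f) := by
  have h1 := (tendsto_pushFilter u f.1 op hop.measurable)
  rw [hh] at h1
  exact tendsto_nhds_unique (h1.mono_right (le_ultLim u h))
    ((hop.tendsto _).mono_left (le_ultLim u f))

theorem ultLim_binop (u : Ult X) (f g h : Linfty X) (op : ℂ × ℂ → ℂ) (hop : Continuous op)
    (hh : Linfty.IsBinop op hop.measurable f g h) :
    ultLim u h = op (ultLim u f, ultLim u g) := by
  obtain ⟨k, h1, h2, h3⟩ := hh
  have t1 := tendsto_pushFilter u k Prod.fst measurable_fst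
  have t2 := tendsto_pushFilter u k Prod.snd measurable_snd
  have t3 := tendsto_pushFilter u k op hop.measurable
  rw [h1] at t1
  rw [h2] at t2
  rw [h3] at t3
  refine tendsto_nhds_unique (t3.mono_right (le_ultLim u h)) ?_
  exact (hop.tendsto _).comp
    ((t1.mono_right (le_ultLim u f)).prodMk_nhds (t2.mono_right (le_ultLim u g)))

theorem ultLim_mem_closure {u : Ult X} {f : Linfty X} {S : MSet ℂ} (h : u ∈ cyl (f.1.toFun S)) :
    ultLim u f ∈ closure S.1 := by
  rw [mem_closure_iff_clusterPt]
  have h1 : S.1 ∈ pushFilter u f.1 := ⟨S, subset_rfl, h⟩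
  exact NeBot.mono (pushFilter_neBot u f.1)
    (le_inf (le_ultLim u f) (Filter.le_principal_iff.2 h1))

theorem mem_cyl_of_ultLim_mem {u : Ult X} {f : Linfty X} {S : MSet ℂ} (hS : IsOpen S.1)
    (h : ultLim u f ∈ S.1) : u ∈ cyl (f.1.toFun S) := by
  obtain ⟨T, h1, h2⟩ := le_ultLim u f (hS.mem_nhds h)
  exact cyl_mono (SigmaHom.mono f.1 h1) h2

/-- The point of the spectrum of `L^∞(X)` given by an ultrafilter. -/
noncomputable def ultPoint (u : Ult X) : Stone X where
  toFun := ultLim u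
  map_one := by
    have h := ultLim_mem_closure (u := u) (f := Linfty.one X) (S := ⟨{1}, measurableSet_singleton 1⟩)
      (by
        have : (Linfty.one X).1.toFun ⟨{1}, measurableSet_singleton 1⟩ = ⊤ := if_pos rfl
        rw [this, cyl_top]
        exact mem_univ u)
    simpa using h
  map_smul c f := ultLim_map u f _ (fun z => c * z) (continuous_const.mul continuous_id) rfl
  map_conj f := ultLim_map u f _ (starRingEnd ℂ) Complex.continuous_conj rfl
  map_add f g h H := ultLim_binop u f g h _ (continuous_fst.add continuous_snd) H
  map_mul f g h H := ultLim_binop u f g h _ (continuous_fst.mul continuous_snd) H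

/-- An increasing exhaustion of an open set of `ℂ`. -/
theorem exists_exhaustion (O : Set ℂ) (hO : IsOpen O) : ∃ K : ℕ → Set ℂ, (∀ n, IsClosed (K n)) ∧
    Monotone K ∧ (⋃ n, K n) = O ∧ ⋃ n, interior (K n) = O := by
  let d : ℂ → ENNReal := fun z => Metric.infEDist z Oᶜ
  have hd : Continuous d := Metric.continuous_infEDist
  have hpos : ∀ z, 0 < d z ↔ z ∈ O := by
    intro z
    rw [pos_iff_ne_zero, Ne, ← Metric.mem_closure_iff_infEDist_zero, hO.isClosed_compl.closure_eq]
    simp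
  let K : ℕ → Set ℂ := fun n => {z | ((n : ENNReal) + 1)⁻¹ ≤ d z}
  have hint : ∀ n : ℕ, {z | ((n : ENNReal) + 1)⁻¹ < d z} ⊆ interior (K n) := fun n =>
    interior_maximal (by
      intro z hz
      simp only [K, mem_ofPred_eq] at hz ⊢
      exact hz.le) (isOpen_lt continuous_const hd)
  have hsub : ∀ n, K n ⊆ O := fun n z (hz : ((n : ENNReal) + 1)⁻¹ ≤ d z) =>
    (hpos z).1 (lt_of_lt_of_le (ENNReal.inv_pos.2 (by finiteness)) hz)
  have hsup : O ⊆ ⋃ n, interior (K n) := by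
    intro z hz
    obtain ⟨n, hn⟩ := ENNReal.exists_inv_nat_lt ((hpos z).2 hz).ne'
    refine mem_iUnion.2 ⟨n, hint n (lt_of_le_of_lt ?_ hn)⟩
    exact ENNReal.inv_le_inv.2 le_self_add
  refine ⟨K, fun n => isClosed_le continuous_const hd, ?_, ?_, ?_⟩
  · intro m n hmn z (hz : ((m : ENNReal) + 1)⁻¹ ≤ d z)
    refine le_trans (ENNReal.inv_le_inv.2 ?_) hz
    gcongr
  · exact subset_antisymm (iUnion_subset hsub)
      (hsup.trans (iUnion_mono fun n => interior_subset))
  · exact subset_antisymm (iUnion_subset fun n => interior_subset.trans (hsub n)) hsup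

theorem preimage_ultLim (f : Linfty X) {O : Set ℂ} {K : ℕ → Set ℂ}
    (hK : ∀ n, IsClosed (K n)) (h1 : (⋃ n, K n) = O) (h2 : ⋃ n, interior (K n) = O) :
    (fun u : Ult X => ultLim u f) ⁻¹' O = ⋃ n, cyl (f.1.toFun ⟨K n, (hK n).measurableSet⟩) := by
  ext u
  simp only [mem_preimage, mem_iUnion]
  constructor
  · intro h
    rw [← h2] at h
    obtain ⟨n, hn⟩ := mem_iUnion.1 h
    refine ⟨n, cyl_mono (SigmaHom.mono f.1 ?_) (mem_cyl_of_ultLim_mem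
      (S := ⟨interior (K n), isOpen_interior.measurableSet⟩) isOpen_interior hn)⟩
    exact interior_subset (s := K n)
  · rintro ⟨n, hn⟩
    have := ultLim_mem_closure hn
    rw [(hK n).closure_eq] at this
    rw [← h1]
    exact mem_iUnion.2 ⟨n, this⟩

theorem continuous_ultPoint : Continuous (ultPoint : Ult X → Stone X) := by
  refine continuous_induced_rng.2 (continuous_pi fun f => ?_)
  refine continuous_def.2 fun O hO => ?_
  obtain ⟨K, hK, -, h1, h2⟩ := exists_exhaustion O hO
  change IsOpen ((fun u : Ult X => ultLim u f) ⁻¹' O)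
  rw [preimage_ultLim f hK h1 h2]
  exact isOpen_iUnion fun n => isOpen_cyl _

theorem measurable_of_continuous_ult (g : Ult X → ℂ) (hg : Continuous g) : Measurable g := by
  refine measurable_of_isOpen fun O hO => ?_
  obtain ⟨K, hK, -, h1, h2⟩ := exists_exhaustion O hO
  have key : ∀ n, ∃ E : X.carrier, g ⁻¹' (K n) ⊆ cyl E ∧ cyl E ⊆ g ⁻¹' O := by
    intro n
    have hc : IsCompact (g ⁻¹' (K n)) := ((hK n).preimage hg).isCompact
    have hsub : g ⁻¹' (K n) ⊆ g ⁻¹' O := by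
      rw [← h1]; exact preimage_mono (subset_iUnion K n)
    refine hc.induction_on (p := fun s => ∃ E : X.carrier, s ⊆ cyl E ∧ cyl E ⊆ g ⁻¹' O)
      ⟨⊥, by simp, by simp [cyl_bot]⟩ ?_ ?_ ?_
    · rintro s t hst ⟨E, hE, hE'⟩
      exact ⟨E, hst.trans hE, hE'⟩
    · rintro s t ⟨E, hE, hE'⟩ ⟨F, hF, hF'⟩
      refine ⟨E ⊔ F, ?_, ?_⟩
      · rw [cyl_sup]; exact union_subset_union hE hF
      · rw [cyl_sup]; exact union_subset hE' hF'
    · intro u hu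
      obtain ⟨_, ⟨a, rfl⟩, ha, ha'⟩ :=
        PrimeSpectrum.isTopologicalBasis_basic_opens.exists_subset_of_mem_open (hsub hu)
          (hO.preimage hg)
      exact ⟨cyl (ofBoolRing a), mem_nhdsWithin_of_mem_nhds ((isOpen_cyl _).mem_nhds ha),
        ofBoolRing a, subset_rfl, ha'⟩
  choose E hE hE' using key
  have : g ⁻¹' O = ⋃ n, cyl (E n) := by
    refine subset_antisymm ?_ (iUnion_subset hE')
    rw [← h1, preimage_iUnion]
    exact iUnion_mono hE
  rw [this]
  exact MeasurableSet.iUnion fun n => measurableSet_cyl _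

theorem measurable_ultPoint : Measurable (ultPoint : Ult X → Stone X) := by
  refine Measurable.of_le_map ?_
  refine iSup_le fun f => ?_
  rw [MeasurableSpace.comap_le_iff_le_map, ← MeasurableSpace.comap_le_iff_le_map]
  have := measurable_of_continuous_ult (fun u : Ult X => f (ultPoint u))
    (f.continuous.comp continuous_ultPoint)
  rintro _ ⟨S, hS, rfl⟩
  exact this hS

theorem ultLim_measurable (f : Linfty X) : Measurable fun u : Ult X => ultLim u f :=
  measurable_of_continuous_ult _ (((continuous_apply f).comp continuous_induced_dom).comp
    continuous_ultPoint)

theorem map_ultLim (f : Linfty X) : (ultMeasure X).map (fun u => ultLim u f) = f.1.law := by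
  have key : ∀ O : Set ℂ, IsOpen O → (ultMeasure X).map (fun u => ultLim u f) O = f.1.law O := by
    intro O hO
    obtain ⟨K, hK, hmono, h1, h2⟩ := exists_exhaustion O hO
    rw [Measure.map_apply (ultLim_measurable f) hO.measurableSet]
    have h3 := preimage_ultLim f hK h1 h2
    have hm : Monotone fun n => cyl (f.1.toFun ⟨K n, (hK n).measurableSet⟩) := fun m n hmn =>
      cyl_mono (SigmaHom.mono f.1 (hmono hmn))
    rw [h3, hm.measure_iUnion, ← h1, hmono.measure_iUnion]
    refine iSup_congr fun n => ?_
    rw [ultMeasure_cyl, AbsMor.law_apply]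
  have : IsProbabilityMeasure ((ultMeasure X).map (fun u => ultLim u f)) :=
    Measure.isProbabilityMeasure_map (ultLim_measurable f).aemeasurable
  exact ext_of_generate_finite {s : Set ℂ | IsOpen s} (BorelSpace.measurable_eq (α := ℂ))
    isPiSystem_isOpen key (key univ isOpen_univ)

theorem measurable_eval (f : Linfty X) : Measurable fun χ : Stone X => χ.toFun f := by
  have hc : Continuous fun χ : Stone X => χ.toFun f :=
    (continuous_apply f).comp continuous_induced_dom
  have h1 : MeasurableSpace.comap (fun χ : Stone X => χ.toFun f) (borel ℂ) ≤ baire (Stone X) :=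
    le_iSup (fun g : C(Stone X, ℂ) => MeasurableSpace.comap g (borel ℂ)) ⟨_, hc⟩
  intro S hS
  rw [BorelSpace.measurable_eq (α := ℂ)] at hS
  exact h1 _ ⟨S, hS, rfl⟩

end Existence

/-- The Riesz representation of the trace of `L^∞(X)` exists. -/
theorem exists_representsTrace (X : ProbAlg.{u}) :
    ∃ ν : Measure (Stone X), IsProbabilityMeasure ν ∧ RepresentsTrace X ν := by
  refine ⟨(ultMeasure X).map ultPoint,
    Measure.isProbabilityMeasure_map measurable_ultPoint.aemeasurable, fun f => ?_⟩
  rw [integral_map measurable_ultPoint.aemeasurable (measurable_eval f).aestronglyMeasurable,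
    Linfty.trace, ← map_ultLim f,
    integral_map (f := fun z : ℂ => z) (ultLim_measurable f).aemeasurable
      measurable_id.aestronglyMeasurable]
  rfl

/-- The measure of the canonical model: the (unique) probability measure on the Baire sets of the
spectrum of `L^∞(X)` which represents the trace. (On a compact Hausdorff space every probability
measure on the Baire sets is Radon.) -/
noncomputable def stoneMeasure (X : ProbAlg.{u}) : Measure (Stone X) :=
  (exists_representsTrace X).choose

/-! ### Disintegrations -/

/-- A family `(μ_y)` of measures on `Stone(X)`, indexed by the points of `Stone(Y)`, is a canonical
disintegration over `π : X → Y` if it consists of Radon probability measures, depends continuously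
on `y` in the vague topology and disintegrates the measure of `Stone(X)` over `Stone(π)`. -/
structure IsCanonicalDisintegration {X : ProbAlg.{u}} {Y : ProbAlg.{v}} (π : ProbAlg.Hom X Y)
    (μ : Stone Y → Measure (Stone X)) : Prop where
  isProbabilityMeasure : ∀ y, IsProbabilityMeasure (μ y)
  isRadon : ∀ y, IsRadon (μ y)
  continuous_integral : ∀ f : C(Stone X, ℂ), Continuous fun y => ∫ x, f x ∂(μ y)
  integral_eq : ∀ (f : C(Stone X, ℂ)) (g : C(Stone Y, ℂ)),
    ∫ x, f x * g (Stone.map π x) ∂(stoneMeasure X) =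
      ∫ y, (∫ x, f x ∂(μ y)) * g y ∂(stoneMeasure Y)

end CanonicalModel

open CanonicalModel

namespace CanonicalModel

/-! ### Characteristic functions in `L^∞(X)` -/

/-! The canonical model is the Stone space of the algebra of `X`. A character takes the values 0 and
1 on characteristic functions, since these are idempotent, so it defines an ultrafilter, and it is
recovered as the limit along that ultrafilter (`ultPoint_toUlt`). Hence the clopen sets `clop E`
separate points, generate the Baire `σ`-algebra, and have indicators with dense span in `C(Stone X,
ℂ)` (`clopInd_induction`). Baire probability measures are determined by their values on these sets,
and by compactness every finitely additive function on the algebra extends to a measure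
(`exists_measure_clop`).

The special feature is that every Baire set agrees almost everywhere with exactly one `clop E`:
existence uses `σ`-completeness and countable additivity, uniqueness the strict positivity of `μ`.
So every bounded Baire function agrees almost everywhere with exactly one continuous function
(`exists_continuous_ae_eq`, `eq_of_continuous_of_ae_eq`).

Over `Stone Y`, the conditional expectation of the indicator of `clop E` therefore has a unique
continuous version `condInd π E`. Its usual almost-everywhere properties (positivity, additivity,
normalisation) are identities between continuous functions, hence hold at every `y`. For fixed `y`
the numbers `condInd π E y` form a finitely additive probability on the algebra, and this is
`fibreMeasure π y`. Continuity and the disintegration formula hold on indicators by construction and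
pass to all continuous functions by density.

Conversely, any canonical disintegration gives `clop E` the mass `condInd π E y`, since this is the
only continuous version (`IsCanonicalDisintegration.measureReal_clop`); this is uniqueness. For a
set pulled back from `F` the version is the indicator of `clop F`. So a compact set off the fibre,
whose image can be separated from `y` by some `clop F`, is null, and inner regularity gives the
support statement. -/

theorem AbsMor.map_map {X : ProbAlg.{u}} {Z W V : Type*} [MeasurableSpace Z] [MeasurableSpace W]
    [MeasurableSpace V] (f : AbsMor X Z) {h : Z → W} (hh : Measurable h) {g : W → V}
    (hg : Measurable g) : (f.map h hh).map g hg = f.map (g ∘ h) (hg.comp hh) :=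
  rfl

theorem AbsMor.map_id' {X : ProbAlg.{u}} {Z : Type*} [MeasurableSpace Z] (f : AbsMor X Z) {h : Z → Z}
    (hh : Measurable h) (hid : ∀ z, h z = z) : f.map h hh = f := by
  obtain rfl : h = id := funext hid
  rfl

theorem AbsMor.map_const {X : ProbAlg.{u}} {Z W : Type*} [MeasurableSpace Z] [MeasurableSpace W]
    (z : Z) {h : Z → W} (hh : Measurable h) :
    (AbsMor.const X z).map h hh = AbsMor.const X (h z) :=
  rfl

theorem AbsMor.map_const_fun {X : ProbAlg.{u}} {Z W : Type*} [MeasurableSpace Z]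
    [MeasurableSpace W] (f : AbsMor X Z) {h : Z → W} (hh : Measurable h) (w : W)
    (hw : ∀ z, h z = w) : f.map h hh = AbsMor.const X w := by
  refine SigmaHom.ext' fun S => ?_
  by_cases hS : w ∈ S.1
  · have h1 : (⟨h ⁻¹' S.1, hh S.2⟩ : MSet Z) = ⊤ :=
      Subtype.ext (eq_univ_of_forall fun z => by simpa [hw] using hS)
    have h2 : (AbsMor.const X w).toFun S = ⊤ := if_pos hS
    rw [h2, ← show f.toFun ⊤ = ⊤ from f.map_top', ← h1]
    rfl
  · have h1 : (⟨h ⁻¹' S.1, hh S.2⟩ : MSet Z) = ⊥ :=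
      Subtype.ext (eq_empty_of_forall_notMem fun z => by simpa [hw] using hS)
    have h2 : (AbsMor.const X w).toFun S = ⊥ := if_neg hS
    rw [h2, ← show f.toFun ⊥ = ⊥ from f.map_bot', ← h1]
    rfl

/-- The abstractly measurable map that agrees with `f` on `E` and with `g` off `E`. -/
def AbsMor.glue {X : ProbAlg.{u}} {Z : Type*} [MeasurableSpace Z] (E : X.carrier)
    (f g : AbsMor X Z) : AbsMor X Z where
  toFun S := (E ⊓ f.toFun S) ⊔ (Eᶜ ⊓ g.toFun S)
  map_sup' S T := by
    rw [show f.toFun (S ⊔ T) = f.toFun S ⊔ f.toFun T from f.map_sup' S T,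
      show g.toFun (S ⊔ T) = g.toFun S ⊔ g.toFun T from g.map_sup' S T,
      inf_sup_left, inf_sup_left, sup_sup_sup_comm]
  map_inf' S T := by
    have h1 : ∀ a b, (E ⊓ a) ⊓ (Eᶜ ⊓ b) = ⊥ := fun a b => by
      rw [inf_inf_inf_comm, inf_compl_eq_bot, bot_inf_eq]
    have h2 : ∀ a b, (Eᶜ ⊓ a) ⊓ (E ⊓ b) = ⊥ := fun a b => by
      rw [inf_inf_inf_comm, compl_inf_eq_bot, bot_inf_eq]
    rw [show f.toFun (S ⊓ T) = f.toFun S ⊓ f.toFun T from f.map_inf' S T,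
      show g.toFun (S ⊓ T) = g.toFun S ⊓ g.toFun T from g.map_inf' S T,
      inf_sup_right, inf_sup_left, inf_sup_left, h1, h2, sup_bot_eq, bot_sup_eq,
      ← inf_inf_distrib_left, ← inf_inf_distrib_left]
  map_top' := by
    rw [show f.toFun ⊤ = ⊤ from f.map_top', show g.toFun ⊤ = ⊤ from g.map_top']
    simp
  map_bot' := by
    rw [show f.toFun ⊥ = ⊥ from f.map_bot', show g.toFun ⊥ = ⊥ from g.map_bot']
    simp
  map_isLUB S s hs := by
    have hf := f.map_isLUB S s hs
    have hg := g.map_isLUB S s hs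
    constructor
    · rintro _ ⟨n, rfl⟩
      exact sup_le_sup (inf_le_inf_left _ (hf.1 ⟨n, rfl⟩)) (inf_le_inf_left _ (hg.1 ⟨n, rfl⟩))
    · intro t ht
      refine sup_le ?_ ?_
      -- Meeting with `E` preserves joins because it is left adjoint to `E ⇨ ·`: the bound `t` for
      -- the meets becomes the bound `E ⇨ t` for the images.
      · have : f.toFun s ≤ E ⇨ t := hf.2 (by
          rintro _ ⟨n, rfl⟩
          rw [le_himp_iff, inf_comm]
          exact le_sup_left.trans (ht ⟨n, rfl⟩))
        rwa [le_himp_iff, inf_comm] at this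
      · have : g.toFun s ≤ Eᶜ ⇨ t := hg.2 (by
          rintro _ ⟨n, rfl⟩
          rw [le_himp_iff, inf_comm]
          exact le_sup_right.trans (ht ⟨n, rfl⟩))
        rwa [le_himp_iff, inf_comm] at this

theorem AbsMor.map_glue {X : ProbAlg.{u}} {Z W : Type*} [MeasurableSpace Z] [MeasurableSpace W]
    (E : X.carrier) (f g : AbsMor X Z) {h : Z → W} (hh : Measurable h) :
    (AbsMor.glue E f g).map h hh = AbsMor.glue E (f.map h hh) (g.map h hh) :=
  rfl

theorem AbsMor.glue_self {X : ProbAlg.{u}} {Z : Type*} [MeasurableSpace Z] (E : X.carrier)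
    (f : AbsMor X Z) : AbsMor.glue E f f = f := by
  refine SigmaHom.ext' fun S => ?_
  change (E ⊓ f.toFun S) ⊔ (Eᶜ ⊓ f.toFun S) = f.toFun S
  rw [← inf_sup_right, sup_compl_eq_top, top_inf_eq]

theorem AbsMor.glue_compl {X : ProbAlg.{u}} {Z : Type*} [MeasurableSpace Z] (E : X.carrier)
    (f g : AbsMor X Z) : AbsMor.glue Eᶜ f g = AbsMor.glue E g f := by
  refine SigmaHom.ext' fun S => ?_
  change (Eᶜ ⊓ f.toFun S) ⊔ (Eᶜᶜ ⊓ g.toFun S) = (E ⊓ g.toFun S) ⊔ (Eᶜ ⊓ f.toFun S)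
  rw [compl_compl, sup_comm]

theorem AbsMor.glue_glue {X : ProbAlg.{u}} {Z : Type*} [MeasurableSpace Z] (E F : X.carrier)
    (f g : AbsMor X Z) :
    AbsMor.glue E (AbsMor.glue F f g) g = AbsMor.glue (E ⊓ F) f g := by
  refine SigmaHom.ext' fun S => ?_
  change (E ⊓ ((F ⊓ f.toFun S) ⊔ (Fᶜ ⊓ g.toFun S))) ⊔ (Eᶜ ⊓ g.toFun S) =
    (E ⊓ F ⊓ f.toFun S) ⊔ ((E ⊓ F)ᶜ ⊓ g.toFun S)
  have h1 : (E ⊓ F)ᶜ = (E ⊓ Fᶜ) ⊔ Eᶜ := by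
    rw [compl_inf, sup_inf_right, sup_compl_eq_top, top_inf_eq, sup_comm]
  rw [h1, inf_sup_left, inf_sup_right, inf_assoc, inf_assoc, sup_assoc]

/-- The characteristic function of `E` as an element of `L^∞(X)`. -/
noncomputable def Linfty.ind {X : ProbAlg.{u}} (E : X.carrier) : Linfty X :=
  ⟨AbsMor.glue E (AbsMor.const X 1) (AbsMor.const X 0), 1, by
    have h1 : (AbsMor.const X (1 : ℂ)).toFun ⟨Metric.closedBall 0 1, measurableSet_closedBall⟩ = ⊤ :=
      if_pos (by simp)
    have h2 : (AbsMor.const X (0 : ℂ)).toFun ⟨Metric.closedBall 0 1, measurableSet_closedBall⟩ = ⊤ :=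
      if_pos (by simp)
    change (E ⊓ _) ⊔ (Eᶜ ⊓ _) = _
    rw [h1, h2]
    simp⟩

theorem Linfty.isMul_ind {X : ProbAlg.{u}} (E F : X.carrier) :
    Linfty.IsMul (Linfty.ind E) (Linfty.ind F) (Linfty.ind (E ⊓ F)) := by
  -- The joint map of the two characteristic functions is constant on each of the four pieces cut
  -- out by `E` and `F`.
  refine ⟨AbsMor.glue E
    (AbsMor.glue F (AbsMor.const X (1, 1)) (AbsMor.const X (1, 0)))
    (AbsMor.glue F (AbsMor.const X (0, 1)) (AbsMor.const X (0, 0))), ?_, ?_, ?_⟩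
  · simp only [AbsMor.map_glue, AbsMor.map_const, AbsMor.glue_self, Linfty.ind]
  · simp only [AbsMor.map_glue, AbsMor.map_const, AbsMor.glue_self, Linfty.ind]
  · simp only [AbsMor.map_glue, AbsMor.map_const, mul_one, mul_zero, AbsMor.glue_self,
      AbsMor.glue_glue, Linfty.ind]

theorem Linfty.isAdd_ind_compl {X : ProbAlg.{u}} (E : X.carrier) :
    Linfty.IsAdd (Linfty.ind E) (Linfty.ind Eᶜ) (Linfty.one X) := by
  refine ⟨AbsMor.glue E (AbsMor.const X (1, 0)) (AbsMor.const X (0, 1)), ?_, ?_, ?_⟩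
  · simp only [AbsMor.map_glue, AbsMor.map_const, Linfty.ind]
  · simp only [AbsMor.map_glue, AbsMor.map_const, Linfty.ind, AbsMor.glue_compl]
  · simp only [AbsMor.map_glue, AbsMor.map_const, add_zero, zero_add, AbsMor.glue_self,
      Linfty.one]

theorem SigmaHom.map_compl {A B : Type*} [BooleanAlgebra A] [BooleanAlgebra B] (f : SigmaHom A B)
    (a : A) : f.toFun aᶜ = (f.toFun a)ᶜ := by
  refine eq_compl_iff_isCompl.2 (IsCompl.of_eq ?_ ?_)
  · rw [← show f.toFun (aᶜ ⊓ a) = f.toFun aᶜ ⊓ f.toFun a from f.map_inf' _ _, compl_inf_eq_bot]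
    exact f.map_bot'
  · rw [← show f.toFun (aᶜ ⊔ a) = f.toFun aᶜ ⊔ f.toFun a from f.map_sup' _ _, compl_sup_eq_top]
    exact f.map_top'

open Classical in
-- The preimage of `T` depends only on which of 0 and 1 lie in `T`. This identifies products
-- computed by composition as characteristic functions.
theorem Linfty.map_indicator {X : ProbAlg.{u}} {Z : Type*} [MeasurableSpace Z] (f : AbsMor X Z)
    (S : MSet Z) (h : Z → ℂ) (hh : Measurable h) (hS : ∀ z, h z = if z ∈ S.1 then 1 else 0) :
    f.map h hh = (Linfty.ind (f.toFun S)).1 := by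
  refine SigmaHom.ext' fun T => ?_
  change f.toFun ⟨h ⁻¹' T.1, hh T.2⟩ = (f.toFun S ⊓ (if (1 : ℂ) ∈ T.1 then ⊤ else ⊥)) ⊔
    ((f.toFun S)ᶜ ⊓ (if (0 : ℂ) ∈ T.1 then ⊤ else ⊥))
  by_cases h1 : (1 : ℂ) ∈ T.1 <;> by_cases h0 : (0 : ℂ) ∈ T.1
  · have : (⟨h ⁻¹' T.1, hh T.2⟩ : MSet Z) = ⊤ := Subtype.ext (eq_univ_of_forall fun z => by
      by_cases hz : z ∈ S.1 <;> simp [hS, hz, h1, h0])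
    rw [this, show f.toFun ⊤ = ⊤ from f.map_top']
    simp [h1, h0]
  · have : (⟨h ⁻¹' T.1, hh T.2⟩ : MSet Z) = S := Subtype.ext (by
      ext z
      by_cases hz : z ∈ S.1 <;> simp [hS, hz, h1, h0])
    rw [this]
    simp [h1, h0]
  · have : (⟨h ⁻¹' T.1, hh T.2⟩ : MSet Z) = Sᶜ := Subtype.ext (by
      ext z
      by_cases hz : z ∈ S.1 <;> simp [hS, hz, h1, h0])
    rw [this, SigmaHom.map_compl]
    simp [h1, h0]
  · have : (⟨h ⁻¹' T.1, hh T.2⟩ : MSet Z) = ⊥ := Subtype.ext (eq_empty_of_forall_notMem fun z => by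
      by_cases hz : z ∈ S.1 <;> simp [hS, hz, h1, h0])
    rw [this, show f.toFun ⊥ = ⊥ from f.map_bot']
    simp [h1, h0]

open Classical in
theorem Linfty.koopman_ind {X : ProbAlg.{u}} {Y : ProbAlg.{v}} (π : ProbAlg.Hom X Y)
    (F : Y.carrier) : Linfty.koopman π (Linfty.ind F) = Linfty.ind (π.pullback.toFun F) := by
  refine Subtype.ext (SigmaHom.ext' fun S => ?_)
  change π.pullback.toFun ((F ⊓ (if (1 : ℂ) ∈ S.1 then ⊤ else ⊥)) ⊔
    (Fᶜ ⊓ (if (0 : ℂ) ∈ S.1 then ⊤ else ⊥))) =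
    (π.pullback.toFun F ⊓ (if (1 : ℂ) ∈ S.1 then ⊤ else ⊥)) ⊔
    ((π.pullback.toFun F)ᶜ ⊓ (if (0 : ℂ) ∈ S.1 then ⊤ else ⊥))
  have h1 : π.pullback.toFun ⊤ = ⊤ := π.pullback.map_top'
  have h0 : π.pullback.toFun ⊥ = ⊥ := π.pullback.map_bot'
  by_cases h : (1 : ℂ) ∈ S.1 <;> by_cases h' : (0 : ℂ) ∈ S.1 <;>
    simp [h, h', h1, h0, SigmaHom.map_compl]

/-! ### Points of the spectrum are ultrafilters -/

section Spectrum

variable {X : ProbAlg.{u}}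

theorem Stone.map_ind_inf (χ : Stone X) (E F : X.carrier) :
    χ.toFun (Linfty.ind (E ⊓ F)) = χ.toFun (Linfty.ind E) * χ.toFun (Linfty.ind F) :=
  χ.map_mul _ _ _ (Linfty.isMul_ind E F)

theorem Stone.map_ind_compl (χ : Stone X) (E : X.carrier) :
    χ.toFun (Linfty.ind Eᶜ) = 1 - χ.toFun (Linfty.ind E) := by
  have := χ.map_add _ _ _ (Linfty.isAdd_ind_compl E)
  rw [χ.map_one] at this
  rw [this]
  ring

theorem Stone.map_ind_top (χ : Stone X) : χ.toFun (Linfty.ind (⊤ : X.carrier)) = 1 := by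
  rw [← χ.map_one]
  congr 1
  refine Subtype.ext (SigmaHom.ext' fun S => ?_)
  change (⊤ ⊓ _) ⊔ (⊤ᶜ ⊓ _) = _
  simp [Linfty.one]

/-- A characteristic function is idempotent, so its value under a character solves `t² = t`. -/
theorem Stone.map_ind_eq (χ : Stone X) (E : X.carrier) :
    χ.toFun (Linfty.ind E) = 0 ∨ χ.toFun (Linfty.ind E) = 1 := by
  have h := χ.map_ind_inf E E
  rw [inf_idem] at h
  have : χ.toFun (Linfty.ind E) * (χ.toFun (Linfty.ind E) - 1) = 0 := by
    linear_combination -h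
  rcases mul_eq_zero.1 this with h | h
  · exact Or.inl h
  · exact Or.inr (sub_eq_zero.1 h)

/-- The ultrafilter given by a point of the spectrum. -/
noncomputable def Stone.toUlt (χ : Stone X) : Ult X where
  asIdeal :=
    { carrier := {a | χ.toFun (Linfty.ind (ofBoolRing a)) = 0}
      zero_mem' := by
        have h := χ.map_ind_compl ⊤
        rw [compl_top, χ.map_ind_top, sub_self] at h
        exact h
      add_mem' := by
        intro a b (ha : _ = _) (hb : _ = _)
        -- The symmetric difference is rewritten with meets and complements only, the operations
        -- whose effect on `χ` is known.
        have h : ofBoolRing (a + b) = ((ofBoolRing a ⊓ (ofBoolRing b)ᶜ)ᶜ ⊓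
            (ofBoolRing b ⊓ (ofBoolRing a)ᶜ)ᶜ)ᶜ := by
          rw [ofBoolRing_add, symmDiff_eq]
          simp
        change χ.toFun (Linfty.ind (ofBoolRing (a + b))) = 0
        rw [h]
        simp only [Stone.map_ind_compl, Stone.map_ind_inf, ha, hb]
        ring
      smul_mem' := by
        intro c a (ha : _ = _)
        change χ.toFun (Linfty.ind (ofBoolRing c ⊓ ofBoolRing a)) = 0
        rw [χ.map_ind_inf, ha, mul_zero] }
  isPrime := by
    refine ⟨fun h => ?_, fun {a b} hab => ?_⟩
    · have h1 := (Ideal.eq_top_iff_one _).1 h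
      change χ.toFun (Linfty.ind ⊤) = 0 at h1
      rw [χ.map_ind_top] at h1
      exact one_ne_zero h1
    · change χ.toFun (Linfty.ind (ofBoolRing a ⊓ ofBoolRing b)) = 0 at hab
      rw [χ.map_ind_inf] at hab
      exact mul_eq_zero.1 hab

theorem Stone.toUlt_mem_cyl (χ : Stone X) (E : X.carrier) :
    χ.toUlt ∈ cyl E ↔ χ.toFun (Linfty.ind E) = 1 := by
  change ¬ χ.toFun (Linfty.ind E) = 0 ↔ _
  rcases χ.map_ind_eq E with h | h <;> simp [h]

theorem Stone.toFun_injective : Function.Injective (Stone.toFun : Stone X → Linfty X → ℂ) := by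
  rintro ⟨f, _⟩ ⟨g, _⟩ h
  congr

open Classical in
-- Where `f` stays at distance at least `r` from `z = χ(f)`, the function `f - z` has a bounded
-- inverse, so the characteristic function of that region is a multiple of `f - z`. As `χ` kills `f
-- - z`, it kills this characteristic function.
theorem Stone.not_mem_cyl (χ : Stone X) (f : Linfty X) {r : ℝ} (hr : 0 < r) :
    χ.toUlt ∉ cyl (f.1.toFun ⟨(Metric.ball (χ.toFun f) r)ᶜ, measurableSet_ball.compl⟩) := by
  rw [Stone.toUlt_mem_cyl]
  intro h1
  set z := χ.toFun f
  let S : MSet ℂ := ⟨(Metric.ball z r)ᶜ, measurableSet_ball.compl⟩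
  -- The inverse of `w - z`, cut off near `z` so that it is bounded by `r⁻¹` and its product with `w
  -- - z` is the indicator of `S`.
  let φ : ℂ → ℂ := fun w => if w ∈ S.1 then (w - z)⁻¹ else 0
  have hφ : Measurable φ :=
    Measurable.ite S.2 (measurable_id.sub_const z).inv measurable_const
  have hb : ∀ w, ‖φ w‖ ≤ r⁻¹ := by
    intro w
    by_cases hw : w ∈ S.1
    · have : r ≤ ‖w - z‖ := by simpa [S, dist_eq_norm] using hw
      simp only [φ, if_pos hw, norm_inv]
      gcongr
    · simp only [φ, if_neg hw, norm_zero]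
      positivity
  obtain ⟨M, hM⟩ := f.2
  let p : Linfty X := ⟨f.1.map φ hφ, r⁻¹, AbsMor.map_bounded hφ (fun w _ => hb w) hM⟩
  let q : Linfty X := ⟨f.1.map (fun w => w - z) (measurable_id.sub_const z), M + ‖z‖,
    AbsMor.map_bounded _ (fun w hw => (norm_sub_le w z).trans (by gcongr)) hM⟩
  have hq : χ.toFun q = 0 := by
    have h2 : Linfty.IsAdd q (Linfty.smul z (Linfty.one X)) f := by
      refine ⟨f.1.map (fun w => (w - z, z))
        ((measurable_id.sub_const z).prodMk measurable_const), rfl, ?_, ?_⟩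
      · rw [AbsMor.map_map]
        refine (AbsMor.map_const_fun f.1 _ z fun w => rfl).trans ?_
        simp only [Linfty.smul, Linfty.one, AbsMor.map_const, mul_one]
      · rw [AbsMor.map_map]
        exact AbsMor.map_id' _ _ fun w => by simp
    have h3 := χ.map_add _ _ _ h2
    rw [χ.map_smul, χ.map_one, mul_one] at h3
    linear_combination -h3
  have hpq : Linfty.IsMul p q (Linfty.ind (f.1.toFun S)) := by
    refine ⟨f.1.map (fun w => (φ w, w - z)) (hφ.prodMk (measurable_id.sub_const z)), rfl, rfl, ?_⟩
    rw [AbsMor.map_map]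
    refine Linfty.map_indicator f.1 S _ _ fun w => ?_
    by_cases hw : w ∈ S.1
    · have : w - z ≠ 0 := by
        rintro h
        rw [sub_eq_zero.1 h] at hw
        exact hw (Metric.mem_ball_self hr)
      simp only [Function.comp_apply, φ, if_pos hw, inv_mul_cancel₀ this]
    · simp only [Function.comp_apply, φ, if_neg hw, zero_mul]
  have h4 := χ.map_mul _ _ _ hpq
  rw [hq, mul_zero] at h4
  exact zero_ne_one (h4.symm.trans h1)

/-- By `Stone.not_mem_cyl` every ball around `χ(f)` belongs to the pushed-forward filter, so `χ(f)`
is its limit. Thus `ultPoint` is surjective and compactness passes from the prime spectrum to `Stone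
X`. -/
theorem ultPoint_toUlt (χ : Stone X) : ultPoint χ.toUlt = χ := by
  refine Stone.toFun_injective (funext fun f => ?_)
  have h : pushFilter χ.toUlt f.1 ≤ 𝓝 (χ.toFun f) := by
    intro T hT
    obtain ⟨r, hr, hrT⟩ := Metric.mem_nhds_iff.1 hT
    refine ⟨⟨Metric.ball (χ.toFun f) r, measurableSet_ball⟩, hrT, ?_⟩
    rcases mem_or_compl χ.toUlt f.1 ⟨Metric.ball (χ.toFun f) r, measurableSet_ball⟩ with h | h
    · exact h
    · exact absurd h (χ.not_mem_cyl f hr)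
  exact tendsto_nhds_unique (f := id) (l := pushFilter χ.toUlt f.1) (le_ultLim χ.toUlt f) h

instance : CompactSpace (Stone X) :=
  (show Function.Surjective (ultPoint : Ult X → Stone X) from
    fun χ => ⟨_, ultPoint_toUlt χ⟩).compactSpace continuous_ultPoint

theorem Stone.continuous_eval (f : Linfty X) : Continuous fun χ : Stone X => χ.toFun f :=
  (continuous_apply f).comp continuous_induced_dom

instance : T2Space (Stone X) :=
  T2Space.of_injective_continuous Stone.toFun_injective continuous_induced_dom

/-! ### The clopen sets of the canonical model -/

/-- The clopen set of the canonical model given by `E`. -/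
def clop (E : X.carrier) : Set (Stone X) := {χ | χ.toFun (Linfty.ind E) = 1}

theorem preimage_toUlt_cyl (E : X.carrier) : Stone.toUlt ⁻¹' cyl E = clop E := by
  ext χ
  exact χ.toUlt_mem_cyl E

theorem clop_inf (E F : X.carrier) : clop (E ⊓ F) = clop E ∩ clop F := by
  simp only [← preimage_toUlt_cyl, cyl_inf, preimage_inter]

theorem clop_sup (E F : X.carrier) : clop (E ⊔ F) = clop E ∪ clop F := by
  simp only [← preimage_toUlt_cyl, cyl_sup, preimage_union]

theorem clop_compl (E : X.carrier) : clop Eᶜ = (clop E)ᶜ := by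
  simp only [← preimage_toUlt_cyl, cyl_compl, preimage_compl]

theorem clop_top : clop (⊤ : X.carrier) = univ := by
  simp only [← preimage_toUlt_cyl, cyl_top, preimage_univ]

theorem clop_bot : clop (⊥ : X.carrier) = ∅ := by
  simp only [← preimage_toUlt_cyl, cyl_bot, preimage_empty]

theorem clop_mono {E F : X.carrier} (h : E ≤ F) : clop E ⊆ clop F := by
  simp only [← preimage_toUlt_cyl]
  exact preimage_mono (cyl_mono h)

theorem Stone.map_ind (χ : Stone X) (E : X.carrier) :
    χ.toFun (Linfty.ind E) = (clop E).indicator 1 χ := by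
  by_cases h : χ ∈ clop E
  · rw [indicator_of_mem h]
    exact h
  · rw [indicator_of_notMem h]
    exact (χ.map_ind_eq E).resolve_right h

theorem isClosed_clop (E : X.carrier) : IsClosed (clop E) :=
  isClosed_eq (Stone.continuous_eval _) continuous_const

theorem isClopen_clop (E : X.carrier) : IsClopen (clop E) :=
  ⟨isClosed_clop E, by rw [← isClosed_compl_iff, ← clop_compl]; exact isClosed_clop _⟩

/-- Characters in the same clopen sets have the same ultrafilter, which determines them by
`ultPoint_toUlt`. -/
theorem exists_clop_of_ne {χ χ' : Stone X} (h : χ ≠ χ') : ∃ E, χ ∈ clop E ∧ χ' ∉ clop E := by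
  by_contra! H
  have key : ∀ E, χ ∈ clop E ↔ χ' ∈ clop E := by
    refine fun E => ⟨H E, fun h' => ?_⟩
    by_contra h2
    have h3 : χ ∈ clop Eᶜ := by rw [clop_compl]; exact h2
    have h4 := H _ h3
    rw [clop_compl] at h4
    exact h4 h'
  have : χ.toUlt = χ'.toUlt := by
    refine PrimeSpectrum.ext (Ideal.ext fun a => not_iff_not.1 ?_)
    have := key (ofBoolRing a)
    rwa [← preimage_toUlt_cyl, mem_preimage, mem_preimage] at this
  exact h (by rw [← ultPoint_toUlt χ, this, ultPoint_toUlt])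

theorem measurableSet_clop (E : X.carrier) : MeasurableSet (clop E) :=
  measurable_eval (Linfty.ind E) (measurableSet_singleton 1)

/-- A continuous function factors through `Stone.toUlt` and a continuous function on ultrafilters.
The latter is measurable for the sets `cyl E`, which pull back to the sets `clop E`. -/
theorem Stone.measurableSpace_eq :
    Stone.instMeasurableSpace X = MeasurableSpace.generateFrom (range (clop (X := X))) := by
  refine le_antisymm (iSup_le fun f => ?_) (MeasurableSpace.generateFrom_le ?_)
  · have h1 : Measurable[MeasurableSpace.generateFrom (range (clop (X := X))), _]
        (Stone.toUlt : Stone X → Ult X) := by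
      refine @measurable_generateFrom _ _ (_) _ _ ?_
      rintro _ ⟨E, rfl⟩
      rw [preimage_toUlt_cyl]
      exact MeasurableSpace.measurableSet_generateFrom ⟨E, rfl⟩
    have h2 := (measurable_of_continuous_ult (fun u : Ult X => f (ultPoint u))
      (f.continuous.comp continuous_ultPoint)).comp h1
    have h3 : (fun u : Ult X => f (ultPoint u)) ∘ Stone.toUlt = f := by
      funext χ
      simp [ultPoint_toUlt]
    rw [h3] at h2
    rintro _ ⟨S, hS, rfl⟩
    rw [← BorelSpace.measurable_eq (α := ℂ)] at hS
    exact h2 hS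
  · rintro _ ⟨E, rfl⟩
    exact measurableSet_clop E

theorem isPiSystem_clop : IsPiSystem (range (clop (X := X))) := by
  rintro _ ⟨E, rfl⟩ _ ⟨F, rfl⟩ -
  exact ⟨E ⊓ F, clop_inf E F⟩

theorem measure_ext_clop {μ ν : Measure (Stone X)} [IsFiniteMeasure μ]
    (h : ∀ E, μ (clop E) = ν (clop E)) : μ = ν := by
  refine ext_of_generate_finite _ Stone.measurableSpace_eq isPiSystem_clop ?_ ?_
  · rintro _ ⟨E, rfl⟩
    exact h E
  · rw [← clop_top]
    exact h ⊤

/-! ### The measure of the canonical model -/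

instance : IsProbabilityMeasure (stoneMeasure X) := (exists_representsTrace X).choose_spec.1

theorem representsTrace_stoneMeasure : RepresentsTrace X (stoneMeasure X) :=
  (exists_representsTrace X).choose_spec.2

theorem ultPoint_mem_clop (u : Ult X) (E : X.carrier) : ultPoint u ∈ clop E ↔ u ∈ cyl E := by
  have key : ∀ E : X.carrier, u ∈ cyl E → ultPoint u ∈ clop E := by
    intro E hE
    have h1 : (Linfty.ind E).1.toFun ⟨{1}, measurableSet_singleton 1⟩ = E := by
      change (E ⊓ (if (1 : ℂ) ∈ ({1} : Set ℂ) then ⊤ else ⊥)) ⊔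
        (Eᶜ ⊓ (if (0 : ℂ) ∈ ({1} : Set ℂ) then ⊤ else ⊥)) = E
      simp
    have h2 := ultLim_mem_closure (u := u) (f := Linfty.ind E)
      (S := ⟨{1}, measurableSet_singleton 1⟩) (by rwa [h1])
    rwa [closure_singleton, mem_singleton_iff] at h2
  refine ⟨fun h => ?_, key E⟩
  by_contra h'
  have := key Eᶜ (by rw [cyl_compl]; exact h')
  rw [clop_compl] at this
  exact this h

theorem trace_ind (E : X.carrier) : (Linfty.ind E).trace = X.μ E := by
  have h1 : ∀ u : Ult X, ultLim u (Linfty.ind E) = (cyl E).indicator 1 u := by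
    intro u
    rw [show ultLim u (Linfty.ind E) = (ultPoint u).toFun (Linfty.ind E) from rfl, Stone.map_ind]
    by_cases h : u ∈ cyl E
    · rw [indicator_of_mem h, indicator_of_mem ((ultPoint_mem_clop u E).2 h)]
      rfl
    · rw [indicator_of_notMem h, indicator_of_notMem (mt (ultPoint_mem_clop u E).1 h)]
  rw [Linfty.trace, ← map_ultLim, integral_map (f := fun z : ℂ => z)
    (ultLim_measurable _).aemeasurable measurable_id.aestronglyMeasurable]
  simp only [h1]
  rw [integral_indicator (measurableSet_cyl E)]
  simp [Measure.real, ultMeasure_cyl, ENNReal.toReal_ofReal (X.μ_mem E).1]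

/-- `stoneMeasure` is only known to represent the trace; testing on characteristic functions fixes
its values on clopen sets. -/
theorem stoneMeasure_clop (E : X.carrier) :
    stoneMeasure X (clop E) = ENNReal.ofReal (X.μ E) := by
  have h := representsTrace_stoneMeasure (Linfty.ind E)
  simp only [Stone.map_ind] at h
  rw [integral_indicator (measurableSet_clop E), trace_ind] at h
  simp only [Pi.one_apply, integral_const, measureReal_restrict_apply_univ, Complex.real_smul,
    mul_one, Complex.ofReal_inj] at h
  rw [← h, Measure.real, ENNReal.ofReal_toReal (measure_ne_top _ _)]

end Spectrum

/-! ### Measurable functions and continuous functions on the canonical model -/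

section Representatives

variable {X : ProbAlg.{u}}

theorem exists_clop_of_isCompact {K : Set (Stone X)} (hK : IsCompact K) {χ : Stone X}
    (hχ : χ ∉ K) : ∃ E, K ⊆ clop E ∧ χ ∉ clop E := by
  refine hK.induction_on (p := fun K => ∃ E, K ⊆ clop E ∧ χ ∉ clop E) ⟨⊥, by simp, by simp [clop_bot]⟩
    ?_ ?_ ?_
  · rintro s t hst ⟨E, hE, hE'⟩
    exact ⟨E, hst.trans hE, hE'⟩
  · rintro s t ⟨E, hE, hE'⟩ ⟨F, hF, hF'⟩
    refine ⟨E ⊔ F, ?_, ?_⟩ <;> rw [clop_sup]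
    · exact union_subset_union hE hF
    · exact fun h => h.elim hE' hF'
  · intro ψ hψ
    obtain ⟨E, hE, hE'⟩ := exists_clop_of_ne (show ψ ≠ χ by rintro rfl; exact hχ hψ)
    exact ⟨clop E, mem_nhdsWithin_of_mem_nhds ((isClopen_clop E).isOpen.mem_nhds hE), E,
      subset_rfl, hE'⟩

theorem measurable_of_continuous {f : Stone X → ℂ} (hf : Continuous f) : Measurable f := by
  intro S hS
  rw [BorelSpace.measurable_eq (α := ℂ)] at hS
  exact le_iSup (fun g : C(Stone X, ℂ) => MeasurableSpace.comap g (borel ℂ)) ⟨f, hf⟩ _ ⟨S, hS, rfl⟩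

theorem integrable_of_continuous {f : Stone X → ℂ} (hf : Continuous f) (ν : Measure (Stone X))
    [IsFiniteMeasure ν] : Integrable f ν := by
  obtain ⟨C, hC⟩ := (isCompact_range hf).isBounded.exists_norm_le
  exact Integrable.of_bound (measurable_of_continuous hf).aestronglyMeasurable C
    (ae_of_all _ fun χ => hC _ ⟨χ, rfl⟩)

/-- Strict positivity of `μ`: the only null clopen set of this form comes from `⊥`. So no
information is lost modulo null sets. -/
theorem le_of_clop_ae_le {E F : X.carrier} (h : clop E ≤ᵐ[stoneMeasure X] clop F) : E ≤ F := by
  have h1 : stoneMeasure X (clop (E ⊓ Fᶜ)) = 0 := by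
    rw [clop_inf, clop_compl, ← Set.sdiff_eq]
    exact ae_le_set.1 h
  rw [stoneMeasure_clop, ENNReal.ofReal_eq_zero] at h1
  have h2 : E ⊓ Fᶜ = ⊥ := by
    by_contra h'
    exact absurd (X.μ_pos _ h') (not_lt.2 h1)
  rw [← compl_compl F]
  exact (disjoint_iff.2 h2).le_compl_right

theorem eq_of_clop_ae_eq {E F : X.carrier} (h : clop E =ᵐ[stoneMeasure X] clop F) : E = F :=
  le_antisymm (le_of_clop_ae_le h.le) (le_of_clop_ae_le h.symm.le)

/-- The union can be strictly smaller than `clop s`, but countable additivity of `μ`, applied to the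
disjointed sequence, gives both the same mass. -/
theorem clop_ae_eq_iUnion {E : ℕ → X.carrier} {s : X.carrier} (hs : IsLUB (range E) s) :
    clop s =ᵐ[stoneMeasure X] ⋃ n, clop (E n) := by
  have hsub : (⋃ n, clop (E n)) ⊆ clop s := iUnion_subset fun n => clop_mono (hs.1 ⟨n, rfl⟩)
  refine (ae_eq_of_subset_of_measure_ge hsub ?_
    (MeasurableSet.iUnion fun n => measurableSet_clop _).nullMeasurableSet (measure_ne_top _ _)).symm
  have hd : ∀ m n, m ≠ n → disjointed E m ⊓ disjointed E n = ⊥ := fun m n hmn =>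
    (disjoint_disjointed E hmn).eq_bot
  have hlub : IsLUB (range (disjointed E)) s := by
    constructor
    · rintro _ ⟨n, rfl⟩
      exact (disjointed_le E n).trans (hs.1 ⟨n, rfl⟩)
    · intro t ht
      refine hs.2 ?_
      rintro _ ⟨n, rfl⟩
      refine (le_partialSups E n).trans ?_
      rw [← partialSups_disjointed]
      exact partialSups_le _ _ _ fun i _ => ht ⟨i, rfl⟩
  have hsum := X.μ_hasSum _ hd s hlub
  have h1 : stoneMeasure X (⋃ n, clop (disjointed E n)) = stoneMeasure X (clop s) := by
    rw [measure_iUnion (fun m n hmn => ?_) fun n => measurableSet_clop _]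
    · simp only [stoneMeasure_clop]
      rw [← ENNReal.ofReal_tsum_of_nonneg (fun n => (X.μ_mem _).1) hsum.summable, hsum.tsum_eq]
    · rw [Function.onFun, Set.disjoint_iff_inter_eq_empty, ← clop_inf, hd m n hmn, clop_bot]
  rw [← h1]
  exact measure_mono (iUnion_mono fun n => clop_mono (disjointed_le E n))

/-- The class of such sets contains the generators and is a `σ`-algebra: countable unions are
represented by joins, which exist by `σ`-completeness. -/
theorem exists_clop_ae_eq {A : Set (Stone X)} (hA : MeasurableSet A) :
    ∃ E, clop E =ᵐ[stoneMeasure X] A := by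
  rw [Stone.measurableSpace_eq] at hA
  refine MeasurableSpace.generateFrom_induction _
    (fun A _ => ∃ E, clop E =ᵐ[stoneMeasure X] A) ?_ ?_ ?_ ?_ A hA
  · rintro _ ⟨E, rfl⟩ -
    exact ⟨E, ae_eq_refl _⟩
  · exact ⟨⊥, by rw [clop_bot]; exact ae_eq_refl _⟩
  · rintro A - ⟨E, hE⟩
    exact ⟨Eᶜ, by rw [clop_compl]; exact hE.compl⟩
  · intro A _ h
    choose E hE using h
    obtain ⟨s, hs⟩ := X.exists_isLUB E
    exact ⟨s, (clop_ae_eq_iUnion hs).trans (Filter.EventuallyEq.countable_iUnion hE)⟩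

/-- The element of the algebra of `X` given by a Baire set of the canonical model. -/
noncomputable def clsOf (A : MSet (Stone X)) : X.carrier := (exists_clop_ae_eq A.2).choose

theorem clop_clsOf (A : MSet (Stone X)) : clop (clsOf A) =ᵐ[stoneMeasure X] A.1 :=
  (exists_clop_ae_eq A.2).choose_spec

/-- The abstractly measurable map defined by a measurable map on the canonical model. -/
noncomputable def AbsMor.ofMeasurable {Z : Type*} [MeasurableSpace Z] (h : Stone X → Z)
    (hh : Measurable h) : AbsMor X Z where
  toFun S := clsOf ⟨h ⁻¹' S.1, hh S.2⟩
  map_sup' S T := by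
    refine eq_of_clop_ae_eq ?_
    rw [clop_sup]
    exact (clop_clsOf _).trans ((clop_clsOf ⟨h ⁻¹' S.1, hh S.2⟩).union
      (clop_clsOf ⟨h ⁻¹' T.1, hh T.2⟩)).symm
  map_inf' S T := by
    refine eq_of_clop_ae_eq ?_
    rw [clop_inf]
    exact (clop_clsOf _).trans ((clop_clsOf ⟨h ⁻¹' S.1, hh S.2⟩).inter
      (clop_clsOf ⟨h ⁻¹' T.1, hh T.2⟩)).symm
  map_top' := by
    refine eq_of_clop_ae_eq ?_
    rw [clop_top]
    exact clop_clsOf _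
  map_bot' := by
    refine eq_of_clop_ae_eq ?_
    rw [clop_bot]
    exact clop_clsOf _
  map_isLUB E s hs := by
    rw [MSet.isLUB_iff] at hs
    have h1 : clop (clsOf ⟨h ⁻¹' s.1, hh s.2⟩) =ᵐ[stoneMeasure X]
        ⋃ n, clop (clsOf ⟨h ⁻¹' (E n).1, hh (E n).2⟩) := by
      refine (clop_clsOf _).trans ?_
      change h ⁻¹' s.1 =ᵐ[stoneMeasure X] _
      rw [hs, preimage_iUnion]
      exact (Filter.EventuallyEq.countable_iUnion fun n => clop_clsOf ⟨h ⁻¹' (E n).1, hh (E n).2⟩).symm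
    constructor
    · rintro _ ⟨n, rfl⟩
      refine le_of_clop_ae_le (EventuallyLE.trans ?_ h1.symm.le)
      exact (subset_iUnion (fun n => clop (clsOf ⟨h ⁻¹' (E n).1, hh (E n).2⟩)) n).eventuallyLE
    · intro t ht
      refine le_of_clop_ae_le (h1.le.trans (LE.le.eventuallyLE ?_))
      exact iUnion_subset fun n => clop_mono (ht ⟨n, rfl⟩)

/-- The value `χ(f)` is a limit along a filter containing `S`; hence only the closure can be
reached. -/
theorem Stone.mem_closure_of_mem_clop {χ : Stone X} {f : Linfty X} {S : MSet ℂ}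
    (h : χ ∈ clop (f.1.toFun S)) : χ.toFun f ∈ closure S.1 := by
  rw [← preimage_toUlt_cyl] at h
  have := ultLim_mem_closure h
  rwa [show ultLim χ.toUlt f = (ultPoint χ.toUlt).toFun f from rfl, ultPoint_toUlt] at this

/-- Every bounded measurable function on the canonical model agrees almost everywhere with a
continuous function. -/
theorem exists_continuous_ae_eq {h : Stone X → ℂ} (hh : Measurable h) {M : ℝ}
    (hM : ∀ᵐ χ ∂stoneMeasure X, ‖h χ‖ ≤ M) :
    ∃ g : C(Stone X, ℂ), g =ᵐ[stoneMeasure X] h := by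
  -- The preimages under `h`, taken modulo null sets, define an element of `L^∞(X)`; its Gelfand
  -- transform is the continuous representative.
  let f : Linfty X := ⟨AbsMor.ofMeasurable h hh, M, by
    refine eq_of_clop_ae_eq ((clop_clsOf _).trans ?_)
    rw [clop_top]
    refine eventuallyEq_univ.2 ?_
    filter_upwards [hM] with χ hχ
    simpa using hχ⟩
  refine ⟨⟨fun χ => χ.toFun f, Stone.continuous_eval f⟩, ?_⟩
  let 𝓑 := TopologicalSpace.countableBasis ℂ
  have hB := TopologicalSpace.isBasis_countableBasis ℂ
  -- A countable basis allows one null set to serve for all basic sets at once.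
  have key : ∀ᵐ χ ∂stoneMeasure X, ∀ S : 𝓑, h χ ∈ S.1 → χ.toFun f ∈ closure S.1 := by
    have : Countable 𝓑 := (TopologicalSpace.countable_countableBasis ℂ).to_subtype
    refine ae_all_iff.2 fun S => ?_
    have hS : MeasurableSet S.1 := (hB.isOpen S.2).measurableSet
    have h1 := clop_clsOf ⟨h ⁻¹' S.1, hh hS⟩
    filter_upwards [h1.symm.le] with χ hχ hχS
    exact Stone.mem_closure_of_mem_clop (S := ⟨S.1, hS⟩) (hχ hχS)
  filter_upwards [key] with χ hχ
  by_contra hne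
  change χ.toFun f ≠ h χ at hne
  -- By regularity of `ℂ`, a closed neighbourhood of `h χ` omits `χ(f)`; a basic set inside it
  -- contradicts the choice of `χ`.
  obtain ⟨T, hT, hTc, hTs⟩ := exists_mem_nhds_isClosed_subset
    (isOpen_compl_singleton.mem_nhds (show h χ ∈ ({χ.toFun f}ᶜ : Set ℂ) from hne.symm))
  obtain ⟨S, hS, hS1, hS2⟩ := hB.mem_nhds_iff.1 hT
  exact hTs (closure_minimal hS2 hTc (hχ ⟨S, hS⟩ hS1)) rfl

/-- `stoneMeasure` has full support: a nonempty open set of disagreement would contain a nonempty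
clopen set, which has positive measure. -/
theorem eq_of_continuous_of_ae_eq {f g : Stone X → ℂ} (hf : Continuous f) (hg : Continuous g)
    (h : f =ᵐ[stoneMeasure X] g) : f = g := by
  by_contra hne
  obtain ⟨χ, hχ⟩ := Function.ne_iff.1 hne
  obtain ⟨E, hE, hE'⟩ := exists_clop_of_isCompact (isClosed_eq hf hg).isCompact (χ := χ) hχ
  have h1 : χ ∈ clop Eᶜ := by rw [clop_compl]; exact hE'
  have h2 : stoneMeasure X (clop Eᶜ) = 0 := by
    refine measure_mono_null ?_ (ae_iff.1 h)
    rw [clop_compl]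
    exact compl_subset_compl.2 hE
  have h3 : Eᶜ = ⊥ := by
    refine le_bot_iff.1 (le_of_clop_ae_le ?_)
    rw [clop_bot]
    exact ae_le_set.2 (by simpa using h2)
  rw [h3, clop_bot] at h1
  exact h1

theorem eq_of_setIntegral_clop_eq {f g : Stone X → ℂ} (hf : Continuous f) (hg : Continuous g)
    (h : ∀ E, ∫ χ in clop E, f χ ∂stoneMeasure X = ∫ χ in clop E, g χ ∂stoneMeasure X) :
    f = g := by
  refine eq_of_continuous_of_ae_eq hf hg ?_
  refine Integrable.ae_eq_of_forall_setIntegral_eq _ _ (integrable_of_continuous hf _)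
    (integrable_of_continuous hg _) fun A hA _ => ?_
  obtain ⟨E, hE⟩ := exists_clop_ae_eq hA
  rw [← setIntegral_congr_set hE, ← setIntegral_congr_set hE, h]

end Representatives

/-! ### Approximation by characteristic functions -/

section Approximation

variable {X : ProbAlg.{u}}

/-- The characteristic function of `clop E` as a continuous function. -/
noncomputable def clopInd (E : X.carrier) : C(Stone X, ℂ) :=
  ⟨fun χ => χ.toFun (Linfty.ind E), Stone.continuous_eval _⟩

theorem clopInd_apply (E : X.carrier) (χ : Stone X) :
    clopInd E χ = (clop E).indicator 1 χ :=
  χ.map_ind E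

theorem clopInd_mul (E F : X.carrier) : clopInd E * clopInd F = clopInd (E ⊓ F) :=
  ContinuousMap.ext fun χ => (χ.map_ind_inf E F).symm

theorem clopInd_top : clopInd (⊤ : X.carrier) = 1 :=
  ContinuousMap.ext fun χ => χ.map_ind_top

theorem star_clopInd (E : X.carrier) : star (clopInd E) = clopInd E := by
  refine ContinuousMap.ext fun χ => ?_
  rcases χ.map_ind_eq E with h | h <;> simp [clopInd, h]

theorem integral_clopInd (E : X.carrier) (ν : Measure (Stone X)) :
    ∫ χ, clopInd E χ ∂ν = (ν.real (clop E) : ℂ) := by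
  simp only [clopInd_apply]
  rw [integral_indicator (measurableSet_clop E)]
  simp

theorem integral_mul_clopInd (f : Stone X → ℂ) (E : X.carrier) (ν : Measure (Stone X)) :
    ∫ χ, f χ * clopInd E χ ∂ν = ∫ χ in clop E, f χ ∂ν := by
  rw [← integral_indicator (measurableSet_clop E)]
  congr 1
  funext χ
  rw [clopInd_apply]
  by_cases h : χ ∈ clop E <;> simp [h]

/-- A closed linear condition holds for all continuous functions if it holds for the
characteristic functions of the sets `clop E`. -/
theorem clopInd_induction (p : C(Stone X, ℂ) → Prop) (ind : ∀ E, p (clopInd E))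
    (add : ∀ f g, p f → p g → p (f + g)) (smul : ∀ (c : ℂ) f, p f → p (c • f))
    (closed : IsClosed {f | p f}) (f : C(Stone X, ℂ)) : p f := by
  let M : Submonoid C(Stone X, ℂ) :=
    { carrier := range clopInd
      one_mem' := ⟨⊤, clopInd_top⟩
      mul_mem' := by
        rintro _ _ ⟨E, rfl⟩ ⟨F, rfl⟩
        exact ⟨E ⊓ F, (clopInd_mul E F).symm⟩ }
  -- The indicators are closed under products, so the algebra they generate is their linear span and
  -- linear conditions suffice on it; Stone–Weierstrass then gives density.
  have hspan : ∀ f, f ∈ Algebra.adjoin ℂ (range (clopInd (X := X))) ↔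
      f ∈ Submodule.span ℂ (range (clopInd (X := X))) := by
    intro f
    have hM : Submonoid.closure (range (clopInd (X := X))) = M := M.closure_eq
    rw [← Subalgebra.mem_toSubmodule, Algebra.adjoin_eq_span, hM]
    rfl
  let A : StarSubalgebra ℂ C(Stone X, ℂ) :=
    { Algebra.adjoin ℂ (range (clopInd (X := X))) with
      star_mem' := by
        intro f hf
        refine Algebra.adjoin_induction (p := fun f _ => star f ∈
          Algebra.adjoin ℂ (range (clopInd (X := X)))) ?_ ?_ ?_ ?_ hf
        · rintro _ ⟨E, rfl⟩
          rw [star_clopInd]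
          exact Algebra.subset_adjoin ⟨E, rfl⟩
        · intro c
          rw [← algebraMap_star_comm]
          exact Subalgebra.algebraMap_mem _ _
        · intro f g _ _ hf hg
          rw [star_add]
          exact add_mem hf hg
        · intro f g _ _ hf hg
          rw [star_mul]
          exact mul_mem hg hf }
  have hA : A.topologicalClosure = ⊤ := by
    refine ContinuousMap.starSubalgebra_topologicalClosure_eq_top_of_separatesPoints A ?_
    intro χ χ' h
    obtain ⟨E, hE, hE'⟩ := exists_clop_of_ne h
    refine ⟨clopInd E, ⟨clopInd E, Algebra.subset_adjoin ⟨E, rfl⟩, rfl⟩, ?_⟩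
    rw [clopInd_apply, clopInd_apply, indicator_of_mem hE, indicator_of_notMem hE']
    exact one_ne_zero
  have hsub : (A : Set C(Stone X, ℂ)) ⊆ {f | p f} := by
    intro f hf
    refine Submodule.span_induction (p := fun f _ => p f) ?_ ?_ (fun f g _ _ => add f g)
      (fun c f _ => smul c f) ((hspan f).1 hf)
    · rintro _ ⟨E, rfl⟩
      exact ind E
    · simpa using smul 0 _ (ind ⊤)
  have hf : f ∈ A.topologicalClosure := by rw [hA]; trivial
  exact closure_minimal hsub closed hf

end Approximation

/-! ### Baire measures on compact spaces are Radon -/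

/-- A Baire set depends on only countably many continuous functions, which reduces regularity
questions to the metrizable space `ℕ → ℂ`. -/
theorem exists_preimage_of_baire {Z : Type*} [TopologicalSpace Z] {A : Set Z}
    (hA : MeasurableSet[baire Z] A) :
    ∃ (φ : Z → ℕ → ℂ) (B : Set (ℕ → ℂ)), Continuous φ ∧ MeasurableSet B ∧ A = φ ⁻¹' B := by
  rw [baire, MeasurableSpace.measurableSet_iSup] at hA
  induction hA with
  | basic A hA =>
    obtain ⟨f, S, hS, rfl⟩ := hA
    rw [← BorelSpace.measurable_eq (α := ℂ)] at hS
    exact ⟨fun z _ => f z, (fun x => x 0) ⁻¹' S, continuous_pi fun _ => f.continuous,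
      measurable_pi_apply 0 hS, rfl⟩
  | empty => exact ⟨fun _ _ => 0, ∅, continuous_const, MeasurableSet.empty, rfl⟩
  | compl A _ ih =>
    obtain ⟨φ, B, hφ, hB, rfl⟩ := ih
    exact ⟨φ, Bᶜ, hφ, hB.compl, rfl⟩
  | iUnion A _ ih =>
    choose φ B hφ hB h using ih
    -- The pairing function merges countably many sequences of functions into one.
    refine ⟨fun z k => φ k.unpair.1 z k.unpair.2,
      ⋃ n, (fun x k => x (Nat.pair n k)) ⁻¹' B n, ?_, ?_, ?_⟩
    · exact continuous_pi fun k => (continuous_apply _).comp (hφ _)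
    · exact MeasurableSet.iUnion fun n =>
        (measurable_pi_lambda _ fun k => measurable_pi_apply (Nat.pair n k)) (hB n)
    · rw [preimage_iUnion]
      refine iUnion_congr fun n => ?_
      rw [h n]
      ext z
      simp

/-- The image measure on `ℕ → ℂ` is inner regular for closed sets. These are `G_δ` there, and their
preimages are closed in a compact space, hence compact. -/
theorem isRadon_of_isFiniteMeasure {X : ProbAlg.{u}} (ν : Measure (Stone X)) [IsFiniteMeasure ν] :
    IsRadon ν := by
  intro A hA r hr
  obtain ⟨φ, B, hφ, hB, rfl⟩ := exists_preimage_of_baire hA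
  have hm : Measurable φ :=
    measurable_pi_lambda _ fun n => measurable_of_continuous ((continuous_apply n).comp hφ)
  rw [← Measure.map_apply hm hB] at hr
  obtain ⟨K, hKB, hK, hrK⟩ := hB.exists_lt_isClosed_of_ne_top (measure_ne_top _ _) hr
  rw [Measure.map_apply hm hK.measurableSet] at hrK
  exact ⟨φ ⁻¹' K, preimage_mono hKB, ⟨hm hK.measurableSet, (hK.preimage hφ).isCompact,
    hK.isGδ.preimage hφ⟩, hrK⟩

/-! ### Finitely additive functions extend to measures on the canonical model -/

section Extension

variable {X : ProbAlg.{u}}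

theorem clop_injective : Function.Injective (clop : X.carrier → Set (Stone X)) :=
  fun _ _ h => eq_of_clop_ae_eq (by rw [h]; exact ae_eq_refl _)

theorem isSetRing_clop : IsSetRing (range (clop : X.carrier → Set (Stone X))) where
  empty_mem := ⟨⊥, clop_bot⟩
  union_mem := by
    rintro _ _ ⟨E, rfl⟩ ⟨F, rfl⟩
    exact ⟨E ⊔ F, clop_sup E F⟩
  sdiff_mem := by
    rintro _ _ ⟨E, rfl⟩ ⟨F, rfl⟩
    exact ⟨E ⊓ Fᶜ, by rw [clop_inf, clop_compl, Set.sdiff_eq]⟩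

/-- No countable additivity is needed: a clopen set covered by countably many clopen sets is already
covered by finitely many, so `σ`-subadditivity is automatic and Carathéodory extension applies. -/
theorem exists_measure_clop (m : X.carrier → ENNReal) (h0 : m ⊥ = 0)
    (hadd : ∀ E F, E ⊓ F = ⊥ → m (E ⊔ F) = m E + m F) :
    ∃ ν : Measure (Stone X), ∀ E, ν (clop E) = m E := by
  let e : Set (Stone X) → X.carrier := Function.invFun clop
  have he : ∀ E, e (clop E) = E := Function.leftInverse_invFun clop_injective
  let c : AddContent ENNReal (range (clop : X.carrier → Set (Stone X))) :=
    isSetRing_clop.addContent_of_union (fun s => m (e s))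
      (by rw [← clop_bot, he, h0])
      (by
        rintro _ _ ⟨E, rfl⟩ ⟨F, rfl⟩ hd
        rw [← clop_sup, he, he, he]
        refine hadd E F (clop_injective ?_)
        rw [clop_inf, clop_bot]
        exact Set.disjoint_iff_inter_eq_empty.1 hd)
  have hc : c.IsSigmaSubadditive := by
    intro f hf hU
    obtain ⟨E, hE⟩ := hU
    have hcomp : IsCompact (⋃ i, f i) := by
      rw [← hE]
      exact (isClosed_clop E).isCompact
    obtain ⟨t, ht⟩ := hcomp.elim_finite_subcover f
      (fun i => by obtain ⟨F, hF⟩ := hf i; rw [← hF]; exact (isClopen_clop F).isOpen) subset_rfl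
    rw [subset_antisymm ht (iUnion₂_subset fun i _ => subset_iUnion f i)]
    exact (addContent_biUnion_le isSetRing_clop fun n _ => hf n).trans (ENNReal.sum_le_tsum t)
  refine ⟨c.measure isSetRing_clop.isSetSemiring Stone.measurableSpace_eq.le hc, fun E => ?_⟩
  rw [AddContent.measure_eq _ isSetRing_clop.isSetSemiring Stone.measurableSpace_eq hc ⟨E, rfl⟩]
  exact congrArg m (he E)

end Extension

/-! ### Integration of continuous functions -/

section Integration

variable {X : ProbAlg.{u}}

theorem norm_integral_sub_le (ν : Measure (Stone X)) [IsProbabilityMeasure ν]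
    (f g : C(Stone X, ℂ)) : ‖∫ χ, f χ ∂ν - ∫ χ, g χ ∂ν‖ ≤ ‖f - g‖ := by
  rw [← integral_sub (integrable_of_continuous f.continuous ν)
    (integrable_of_continuous g.continuous ν)]
  refine (norm_integral_le_of_norm_le_const (C := ‖f - g‖)
    (ae_of_all _ fun χ => (f - g).norm_coe_le_norm χ)).trans ?_
  simp

theorem continuous_integral_continuousMap (ν : Measure (Stone X)) [IsProbabilityMeasure ν] :
    Continuous fun f : C(Stone X, ℂ) => ∫ χ, f χ ∂ν := by
  refine LipschitzWith.continuous (K := 1) (LipschitzWith.of_dist_le_mul fun f g => ?_)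
  rw [NNReal.coe_one, one_mul, dist_eq_norm, dist_eq_norm]
  exact norm_integral_sub_le ν f g

theorem continuous_integral_of_clopInd {T : Type*} [TopologicalSpace T]
    (μ : T → Measure (Stone X)) (hμ : ∀ y, IsProbabilityMeasure (μ y))
    (h : ∀ E, Continuous fun y => ∫ χ, clopInd E χ ∂μ y) (f : C(Stone X, ℂ)) :
    Continuous fun y => ∫ χ, f χ ∂μ y := by
  refine clopInd_induction (fun f => Continuous fun y => ∫ χ, f χ ∂μ y) h ?_ ?_ ?_ f
  · intro f g hf hg
    refine (hf.add hg).congr fun y => ?_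
    exact (integral_add (integrable_of_continuous f.continuous _)
      (integrable_of_continuous g.continuous _)).symm
  · intro c f hf
    refine (hf.const_smul c).congr fun y => ?_
    exact (integral_smul c _).symm
  -- Integration against a probability measure is 1-Lipschitz in `f`, with the same constant for all
  -- `y`, so uniform limits stay continuous in `y`.
  · refine isClosed_of_closure_subset fun f hf => ?_
    refine continuous_of_uniform_approx_of_continuous fun U hU => ?_
    obtain ⟨ε, hε, hεU⟩ := Metric.mem_uniformity_dist.1 hU
    obtain ⟨g, hg, hfg⟩ := Metric.mem_closure_iff.1 hf ε hε
    refine ⟨_, hg, fun y => hεU ?_⟩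
    rw [dist_eq_norm]
    rw [dist_eq_norm] at hfg
    exact (norm_integral_sub_le (μ y) f g).trans_lt hfg

end Integration

/-! ### Conditional expectations of characteristic functions -/

section Disintegration

variable {X : ProbAlg.{u}} {Y : ProbAlg.{v}} (π : ProbAlg.Hom X Y)

/-! ### The induced map on canonical models -/

theorem Stone.continuous_map : Continuous (Stone.map π) :=
  continuous_induced_rng.2 (continuous_pi fun f => Stone.continuous_eval (Linfty.koopman π f))

theorem preimage_map_clop (F : Y.carrier) :
    Stone.map π ⁻¹' clop F = clop (π.pullback.toFun F) := by
  ext χ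
  change χ.toFun (Linfty.koopman π (Linfty.ind F)) = 1 ↔ _
  rw [Linfty.koopman_ind]
  rfl

theorem clopInd_map (F : Y.carrier) (χ : Stone X) :
    clopInd F (Stone.map π χ) = clopInd (π.pullback.toFun F) χ := by
  change χ.toFun (Linfty.koopman π (Linfty.ind F)) = _
  rw [Linfty.koopman_ind]
  rfl

theorem Stone.measurable_map : Measurable (Stone.map π) := by
  rw [Stone.measurableSpace_eq (X := Y)]
  refine measurable_generateFrom ?_
  rintro _ ⟨F, rfl⟩
  rw [preimage_map_clop]
  exact measurableSet_clop _

theorem map_stoneMeasure : (stoneMeasure X).map (Stone.map π) = stoneMeasure Y := by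
  have : IsProbabilityMeasure ((stoneMeasure X).map (Stone.map π)) :=
    Measure.isProbabilityMeasure_map (Stone.measurable_map π).aemeasurable
  refine measure_ext_clop fun F => ?_
  rw [Measure.map_apply (Stone.measurable_map π) (measurableSet_clop F), preimage_map_clop,
    stoneMeasure_clop, stoneMeasure_clop, π.measure_pullback]

/-- Restrict the measure to `clop E` and push it to `Stone Y`. The result is dominated by
`stoneMeasure Y`, so its Radon–Nikodym density lies in `[0, 1]` almost everywhere and has a
continuous version. The equation with the norm encodes that the version is real and nonnegative. -/
theorem exists_condInd (E : X.carrier) : ∃ g : C(Stone Y, ℂ), (∀ y, (‖g y‖ : ℂ) = g y) ∧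
    ∀ F, ∫ y in clop F, g y ∂stoneMeasure Y = X.μ (E ⊓ π.pullback.toFun F) := by
  let ν := ((stoneMeasure X).restrict (clop E)).map (Stone.map π)
  have hν : ν ≤ stoneMeasure Y := by
    rw [← map_stoneMeasure π]
    exact Measure.map_mono Measure.restrict_le_self (Stone.measurable_map π)
  have : IsFiniteMeasure ν := isFiniteMeasure_of_le _ hν
  let h : Stone Y → ℂ := fun y => ((ν.rnDeriv (stoneMeasure Y) y).toReal : ℂ)
  obtain ⟨g, hg⟩ := exists_continuous_ae_eq (h := h) (M := 1)
    (Complex.measurable_ofReal.comp (Measure.measurable_rnDeriv _ _).ennreal_toReal) (by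
      filter_upwards [Measure.rnDeriv_le_one_of_le hν] with y hy
      simpa [h, Complex.norm_real] using ENNReal.toReal_mono ENNReal.one_ne_top hy)
  refine ⟨g, fun y => ?_, fun F => ?_⟩
  · refine congrFun (eq_of_continuous_of_ae_eq (f := fun y => (‖g y‖ : ℂ))
      (Complex.continuous_ofReal.comp g.continuous.norm) g.continuous ?_) y
    filter_upwards [hg] with y hy
    simp [hy, h, Complex.norm_real]
  · rw [setIntegral_congr_ae (g := h) (measurableSet_clop F) (hg.mono fun y hy _ => hy)]
    simp only [h]
    rw [integral_complex_ofReal, Measure.setIntegral_toReal_rnDeriv (Measure.absolutelyContinuous_of_le hν),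
      Measure.real, Measure.map_apply (Stone.measurable_map π) (measurableSet_clop F),
      preimage_map_clop, Measure.restrict_apply (measurableSet_clop _), inter_comm, ← clop_inf,
      stoneMeasure_clop, ENNReal.toReal_ofReal (X.μ_mem _).1]

/-- The conditional expectation of the characteristic function of `E`, as a continuous function on
the canonical model of the base. -/
noncomputable def condInd (E : X.carrier) : C(Stone Y, ℂ) := (exists_condInd π E).choose

theorem norm_condInd (E : X.carrier) (y : Stone Y) : (‖condInd π E y‖ : ℂ) = condInd π E y :=
  (exists_condInd π E).choose_spec.1 y

theorem setIntegral_condInd (E : X.carrier) (F : Y.carrier) :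
    ∫ y in clop F, condInd π E y ∂stoneMeasure Y = X.μ (E ⊓ π.pullback.toFun F) :=
  (exists_condInd π E).choose_spec.2 F

/-- The almost-everywhere uniqueness of conditional expectations becomes uniqueness at every point,
since both functions are continuous. -/
theorem eq_condInd {E : X.carrier} {g : Stone Y → ℂ} (hg : Continuous g)
    (h : ∀ F, ∫ y in clop F, g y ∂stoneMeasure Y = X.μ (E ⊓ π.pullback.toFun F)) :
    g = condInd π E :=
  eq_of_setIntegral_clop_eq hg (condInd π E).continuous fun F => by
    rw [h, setIntegral_condInd]

theorem condInd_sup {E E' : X.carrier} (h : E ⊓ E' = ⊥) (y : Stone Y) :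
    condInd π (E ⊔ E') y = condInd π E y + condInd π E' y := by
  refine (congrFun (eq_condInd π (g := fun y => condInd π E y + condInd π E' y)
    ((condInd π E).continuous.add (condInd π E').continuous) fun F => ?_) y).symm
  rw [integral_add (integrable_of_continuous (condInd π E).continuous _)
    (integrable_of_continuous (condInd π E').continuous _), setIntegral_condInd,
    setIntegral_condInd, inf_sup_right, μ_sup, Complex.ofReal_add]
  rw [inf_inf_inf_comm, h, bot_inf_eq]

/-- A set coming from `Y` is its own conditional expectation. This yields both the normalisation and
the support on fibres. -/
theorem condInd_pullback (F : Y.carrier) : condInd π (π.pullback.toFun F) = clopInd F := by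
  refine (DFunLike.coe_injective (eq_condInd π (clopInd F).continuous fun F' => ?_)).symm
  rw [← integral_mul_clopInd]
  simp only [← ContinuousMap.mul_apply, clopInd_mul]
  rw [integral_clopInd, Measure.real, stoneMeasure_clop,
    ENNReal.toReal_ofReal (Y.μ_mem _).1, ← π.measure_pullback]
  exact congrArg (fun a => ((X.μ a : ℝ) : ℂ)) (π.pullback.map_inf' F F')

theorem condInd_top (y : Stone Y) : condInd π ⊤ y = 1 := by
  have h := condInd_pullback π ⊤
  rw [show π.pullback.toFun ⊤ = ⊤ from π.pullback.map_top', clopInd_top] at h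
  rw [h, ContinuousMap.one_apply]

/-! ### The canonical disintegration -/

theorem exists_fibre_measure (y : Stone Y) :
    ∃ ν : Measure (Stone X), ∀ E, ν (clop E) = ENNReal.ofReal ‖condInd π E y‖ := by
  have hadd : ∀ E E' : X.carrier, E ⊓ E' = ⊥ →
      ‖condInd π (E ⊔ E') y‖ = ‖condInd π E y‖ + ‖condInd π E' y‖ := by
    intro E E' h
    have := condInd_sup π h y
    rw [← norm_condInd, ← norm_condInd π E, ← norm_condInd π E'] at this
    exact_mod_cast this
  refine exists_measure_clop _ ?_ fun E E' h => ?_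
  -- Additivity on `⊥ ⊔ ⊥ = ⊥` forces the value at `⊥` to vanish.
  · have := hadd ⊥ ⊥ (inf_idem _)
    rw [sup_idem] at this
    rw [show ‖condInd π ⊥ y‖ = 0 by linarith, ENNReal.ofReal_zero]
  · rw [hadd E E' h, ENNReal.ofReal_add (norm_nonneg _) (norm_nonneg _)]

/-- The measure of the canonical disintegration over the point `y`. -/
noncomputable def fibreMeasure (y : Stone Y) : Measure (Stone X) :=
  (exists_fibre_measure π y).choose

theorem fibreMeasure_clop (y : Stone Y) (E : X.carrier) :
    fibreMeasure π y (clop E) = ENNReal.ofReal ‖condInd π E y‖ :=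
  (exists_fibre_measure π y).choose_spec E

instance (y : Stone Y) : IsProbabilityMeasure (fibreMeasure π y) :=
  ⟨by rw [← clop_top, fibreMeasure_clop, condInd_top]; simp⟩

theorem integral_clopInd_fibreMeasure (y : Stone Y) (E : X.carrier) :
    ∫ χ, clopInd E χ ∂fibreMeasure π y = condInd π E y := by
  rw [integral_clopInd, Measure.real, fibreMeasure_clop, ENNReal.toReal_ofReal (norm_nonneg _),
    norm_condInd]

theorem continuous_integral_fibreMeasure (f : C(Stone X, ℂ)) :
    Continuous fun y => ∫ χ, f χ ∂fibreMeasure π y := by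
  refine continuous_integral_of_clopInd _ inferInstance (fun E => ?_) f
  simp only [integral_clopInd_fibreMeasure]
  exact (condInd π E).continuous

/-- Integration over the fibres. -/
noncomputable def fibreIntegral (f : C(Stone X, ℂ)) : C(Stone Y, ℂ) :=
  ⟨fun y => ∫ χ, f χ ∂fibreMeasure π y, continuous_integral_fibreMeasure π f⟩

theorem continuous_fibreIntegral : Continuous (fibreIntegral π) := by
  refine LipschitzWith.continuous (K := 1) (LipschitzWith.of_dist_le_mul fun f g => ?_)
  rw [NNReal.coe_one, one_mul]
  refine (ContinuousMap.dist_le dist_nonneg).2 fun y => ?_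
  rw [dist_eq_norm, dist_eq_norm]
  exact norm_integral_sub_le _ f g

theorem fibreIntegral_add (f g : C(Stone X, ℂ)) :
    fibreIntegral π (f + g) = fibreIntegral π f + fibreIntegral π g :=
  ContinuousMap.ext fun _ => integral_add (integrable_of_continuous f.continuous _)
    (integrable_of_continuous g.continuous _)

theorem fibreIntegral_smul (c : ℂ) (f : C(Stone X, ℂ)) :
    fibreIntegral π (c • f) = c • fibreIntegral π f :=
  ContinuousMap.ext fun _ => integral_smul c _

theorem fibreIntegral_clopInd (E : X.carrier) : fibreIntegral π (clopInd E) = condInd π E :=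
  ContinuousMap.ext fun y => integral_clopInd_fibreMeasure π y E

theorem integral_continuousMap_add (ν : Measure (Stone X)) [IsFiniteMeasure ν]
    (f g : C(Stone X, ℂ)) : ∫ χ, (f + g) χ ∂ν = ∫ χ, f χ ∂ν + ∫ χ, g χ ∂ν :=
  integral_add (integrable_of_continuous f.continuous _) (integrable_of_continuous g.continuous _)

theorem integral_continuousMap_smul (ν : Measure (Stone X)) (c : ℂ) (f : C(Stone X, ℂ)) :
    ∫ χ, (c • f) χ ∂ν = c • ∫ χ, f χ ∂ν :=
  integral_smul c _

/-- Both sides are linear and continuous in `f` and in `g` separately, so two density arguments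
reduce to indicators, where this is the defining property of `condInd`. -/
theorem integral_fibreIntegral_mul (f : C(Stone X, ℂ)) (g : C(Stone Y, ℂ)) :
    ∫ χ, (f * g.comp ⟨Stone.map π, Stone.continuous_map π⟩) χ ∂stoneMeasure X =
      ∫ y, (fibreIntegral π f * g) y ∂stoneMeasure Y := by
  let q : C(Stone X, Stone Y) := ⟨Stone.map π, Stone.continuous_map π⟩
  have hcomp : Continuous fun g : C(Stone Y, ℂ) => g.comp q := ContinuousMap.continuous_precomp q
  refine clopInd_induction (fun f => ∫ χ, (f * g.comp q) χ ∂stoneMeasure X =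
    ∫ y, (fibreIntegral π f * g) y ∂stoneMeasure Y) (fun E => ?_) ?_ ?_ ?_ f
  · refine clopInd_induction (fun g => ∫ χ, (clopInd E * g.comp q) χ ∂stoneMeasure X =
      ∫ y, (fibreIntegral π (clopInd E) * g) y ∂stoneMeasure Y) (fun F => ?_) ?_ ?_ ?_ g
    · have h1 : (clopInd F).comp q = clopInd (π.pullback.toFun F) :=
        ContinuousMap.ext fun χ => clopInd_map π F χ
      rw [h1, clopInd_mul, integral_clopInd, Measure.real, stoneMeasure_clop,
        ENNReal.toReal_ofReal (X.μ_mem _).1, fibreIntegral_clopInd, ← setIntegral_condInd,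
        ← integral_mul_clopInd]
      rfl
    · intro g g' h h'
      rw [ContinuousMap.add_comp, mul_add, mul_add, integral_continuousMap_add,
        integral_continuousMap_add, h, h']
    · intro c g h
      rw [ContinuousMap.smul_comp, mul_smul_comm, mul_smul_comm, integral_continuousMap_smul,
        integral_continuousMap_smul, h]
    · exact isClosed_eq
        ((continuous_integral_continuousMap _).comp (continuous_const.mul hcomp))
        ((continuous_integral_continuousMap _).comp (continuous_const.mul continuous_id))
  · intro f f' h h'
    rw [fibreIntegral_add, add_mul, add_mul, integral_continuousMap_add,
      integral_continuousMap_add, h, h']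
  · intro c f h
    rw [fibreIntegral_smul, smul_mul_assoc, smul_mul_assoc, integral_continuousMap_smul,
      integral_continuousMap_smul, h]
  · exact isClosed_eq
      ((continuous_integral_continuousMap _).comp (continuous_id.mul continuous_const))
      ((continuous_integral_continuousMap _).comp
        ((continuous_fibreIntegral π).mul continuous_const))

theorem isCanonicalDisintegration_fibreMeasure :
    IsCanonicalDisintegration π (fibreMeasure π) where
  isProbabilityMeasure := inferInstance
  isRadon _ := isRadon_of_isFiniteMeasure _
  continuous_integral := continuous_integral_fibreMeasure π
  integral_eq := integral_fibreIntegral_mul π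

/-! ### Uniqueness and support on the fibres -/

variable {π}

/-- The mass of `clop E` is continuous in `y`, and the disintegration formula tested on `clopInd F`
gives it the integrals that characterise `condInd π E`. -/
theorem IsCanonicalDisintegration.measureReal_clop {μ : Stone Y → Measure (Stone X)}
    (hμ : IsCanonicalDisintegration π μ) (y : Stone Y) (E : X.carrier) :
    ((μ y).real (clop E) : ℂ) = condInd π E y := by
  rw [← integral_clopInd]
  refine congrFun (eq_condInd π (hμ.continuous_integral (clopInd E)) fun F => ?_) y
  rw [← integral_mul_clopInd, ← hμ.integral_eq]
  simp only [clopInd_map, ← ContinuousMap.mul_apply, clopInd_mul]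
  rw [integral_clopInd, Measure.real, stoneMeasure_clop, ENNReal.toReal_ofReal (X.μ_mem _).1]

theorem IsCanonicalDisintegration.eq {μ μ' : Stone Y → Measure (Stone X)}
    (hμ : IsCanonicalDisintegration π μ) (hμ' : IsCanonicalDisintegration π μ') : μ = μ' := by
  funext y
  have := hμ.isProbabilityMeasure y
  have := hμ'.isProbabilityMeasure y
  refine measure_ext_clop fun E => ?_
  have h := (hμ.measureReal_clop y E).trans (hμ'.measureReal_clop y E).symm
  exact (measureReal_eq_measureReal_iff (measure_ne_top _ _) (measure_ne_top _ _)).1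
    (Complex.ofReal_injective h)

theorem isCompact_fibre (y : Stone Y) : IsCompact (Stone.map π ⁻¹' {y}) :=
  (isClosed_singleton.preimage (Stone.continuous_map π)).isCompact

/-- Inner regularity reduces to a compact `K` off the fibre. Its image is compact and misses `y`, so
it lies in some `clop F` without `y`, and the preimage of `clop F` has `μ y`-mass equal to the
indicator of `clop F` at `y`, that is 0. -/
theorem IsCanonicalDisintegration.measure_eq_zero {μ : Stone Y → Measure (Stone X)}
    (hμ : IsCanonicalDisintegration π μ) {y : Stone Y} {A : Set (Stone X)} (hA : MeasurableSet A)
    (h : A ∩ Stone.map π ⁻¹' {y} = ∅) : μ y A = 0 := by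
  by_contra hne
  obtain ⟨K, hKA, ⟨-, hK, -⟩, hpos⟩ := hμ.isRadon y hA 0 (pos_iff_ne_zero.2 hne)
  have hy : y ∉ Stone.map π '' K := by
    rintro ⟨χ, hχ, rfl⟩
    exact notMem_empty χ (h ▸ ⟨hKA hχ, rfl⟩)
  obtain ⟨F, hF, hyF⟩ := exists_clop_of_isCompact (hK.image (Stone.continuous_map π)) hy
  have hsub : K ⊆ clop (π.pullback.toFun F) := by
    rw [← preimage_map_clop]
    exact image_subset_iff.1 hF
  have := hμ.isProbabilityMeasure y
  have h0 := hμ.measureReal_clop y (π.pullback.toFun F)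
  rw [condInd_pullback, clopInd_apply, indicator_of_notMem hyF, Complex.ofReal_eq_zero,
    measureReal_eq_zero_iff] at h0
  exact hpos.ne' (measure_mono_null hsub h0)

end Disintegration

end CanonicalModel

/-- Canonical disintegration: for every morphism `π : X → Y` of probability algebras there is a
unique canonical disintegration `(μ_y)`, and each `μ_y` is supported on the compact fibre of
`Stone(π)` over `y`. -/
theorem theorem1p4 (X : ProbAlg.{u}) (Y : ProbAlg.{v}) (π : ProbAlg.Hom X Y) :
    (∃! μ : Stone Y → Measure (Stone X), IsCanonicalDisintegration π μ) ∧
      ∀ μ : Stone Y → Measure (Stone X), IsCanonicalDisintegration π μ →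
        ∀ y : Stone Y, IsCompact (Stone.map π ⁻¹' {y}) ∧
          ∀ E : Set (Stone X), MeasurableSet E → E ∩ Stone.map π ⁻¹' {y} = ∅ → μ y E = 0 := by
  refine ⟨⟨fibreMeasure π, isCanonicalDisintegration_fibreMeasure π, fun μ hμ =>
    hμ.eq (isCanonicalDisintegration_fibreMeasure π)⟩, fun μ hμ y => ⟨isCompact_fibre y, ?_⟩⟩
  exact fun E hE h => hμ.measure_eq_zero hE h
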